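/- Let $U$ and $V$ be real separable Hilbert spaces, let $(T(t))_{t\ge 0}$ be a $C_0$-semigroup of bounded linear operators on $V$, let $B\colon U\to V$ be a bounded linear operator, and let $L=(L(t):t\ge 0)$ be a cylindrical Lévy process in $U$ on a filtered probability space $(\Omega,\mathcal F,(\mathcal F_t)_{t\ge0},P)$; that is, each $L(t)\colon U\to L^0_P(\Omega;\mathbb R)$ is linear and continuous (for convergence in probability) and for all $u_1,\dots,u_n\in U$ the process $((L(t)u_1,\dots,L(t)u_n):t\ge 0)$ is a Lévy process in $\mathbb R^n$ with respect to $(\mathcal F_t)_{t\ge 0}$. Assume that for some $T_0>0$ the map $s\mapsto T(s)B$ is stochastically integrable with respect to $L$ on $[0,T_0]$: for each Borel set $A\subseteq[0,T_0]$ there is a $V$-valued random variable $I_A$ such that, for every $v\in V$, $\langle I_A,v\rangle=\int_0^{T_0}\mathbf 1_A(s)B^*T^*(s)v\,\mathrm dL(s)$ almost surely. (Here, for $U$-valued integrands $g$, $\int_0^{R} g\,\mathrm dL$ is the limit in probability of the sums $\sum_k (L(t_{k+1})-L(t_k))u_k$ belonging to uniformly bounded step functions $\sum_k \mathbf 1_{(t_k,t_{k+1}]}u_k$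 on $[0,R]$ that converge to $g$ Lebesgue-almost everywhere on $[0,R]$.) Then $s\mapsto T(s)B$ is stochastically integrable on $[0,t]$ for every $t\ge 0$; let $\nu_t$ denote the law on the Borel sets of $V$ of the random variable $\int_0^t T(s)B\,\mathrm dL(s)$. For a probability measure $\rho$ on the Borel sets of $V$ put $T_t\rho:=\rho\circ T(t)^{-1}$, and call $\rho$ a stationary measure (for the process $Y(t)=T(t)Y_0+\int_0^tT(t-s)B\,\mathrm dL(s)$) if $\rho=T_t\rho*\nu_t$ for all $t\ge 0$. If $\nu_t$ converges weakly to a probability measure $\nu$ on $V$ as $t\to\infty$, then: (a) $\nu$ is a stationary measure; (b) for every stationary measure $\lambda$ there is a probability measure $\beta$ on the Borel sets of $V$ with $\lambda=\beta*\nu$ and $T_t\beta=\beta$ for all $t\ge 0$. -/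

import Mathlib

open MeasureTheory ProbabilityTheory Filter Topology Set
open scoped NNReal InnerProductSpace

noncomputable section

/-- A strongly continuous one-parameter semigroup (`C₀`-semigroup) of bounded linear operators. -/
structure C0Semigroup (V : Type*) [NormedAddCommGroup V] [NormedSpace ℝ V] where
  toFun : ℝ≥0 → V →L[ℝ] V
  map_zero : toFun 0 = ContinuousLinearMap.id ℝ V
  map_add : ∀ s t : ℝ≥0, toFun (s + t) = (toFun s).comp (toFun t)
  strongly_continuous : ∀ x : V, Continuous fun t : ℝ≥0 => toFun t x

/-- `X` is a Lévy process in `ℝⁿ` with respect to the filtration `ℱ`. Each `X t` only matters up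
to `P`-null sets, so path regularity is expressed by continuity in probability (which provides a
càdlàg modification) and adaptedness is understood up to `P`-null sets. -/
structure IsLevyProcess {Ω : Type*} {mΩ : MeasurableSpace Ω} {n : ℕ}
    (ℱ : Filtration ℝ≥0 mΩ) (P : Measure Ω) (X : ℝ≥0 → Ω → (Fin n → ℝ)) : Prop where
  adapted : ∀ t, AEStronglyMeasurable[ℱ t] (X t) P
  zero : X 0 =ᵐ[P] 0
  indep_increments : ∀ s t, s ≤ t →
    Indep (MeasurableSpace.comap (X t - X s) inferInstance) (ℱ s) P
  stationary_increments : ∀ s t, IdentDistrib (X (s + t) - X s) (X t) P P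
  stochastically_continuous : ∀ s, TendstoInMeasure P X (𝓝 s) (X s)

/-- A cylindrical Lévy process in `U`: a family `L t : U → L⁰_P(Ω; ℝ)` of cylindrical random
variables (linear maps which are continuous for convergence in probability) such that
`(L t u₁, …, L t uₙ)` is a Lévy process in `ℝⁿ` for all `u₁, …, uₙ`. -/
structure CylindricalLevyProcess (U : Type*) [NormedAddCommGroup U] [InnerProductSpace ℝ U]
    {Ω : Type*} {mΩ : MeasurableSpace Ω} (ℱ : Filtration ℝ≥0 mΩ) (P : Measure Ω) where
  toFun : ℝ≥0 → U →ₗ[ℝ] (Ω →ₘ[P] ℝ)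
  continuous_toFun : ∀ (t : ℝ≥0) (u : U),
    TendstoInMeasure P (fun (w : U) (ω : Ω) => toFun t w ω) (𝓝 u) (toFun t u)
  levy : ∀ (n : ℕ) (u : Fin n → U),
    IsLevyProcess ℱ P (fun (t : ℝ≥0) (ω : Ω) (i : Fin n) => toFun t (u i) ω)

/-- Data of a `U`-valued step function `∑_{k < n} 1_{(t k, t (k+1)]} u k`. -/
structure StepFunction (U : Type*) where
  n : ℕ
  t : ℕ → ℝ≥0
  mono : Monotone t
  u : ℕ → U

/-- The step function `∑_{k < n} 1_{(t k, t (k+1)]} u k` as a function on `[0, ∞)`. -/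
def StepFunction.eval {U : Type*} [AddCommMonoid U] (g : StepFunction U) (s : ℝ≥0) : U :=
  ∑ k ∈ Finset.range g.n, (Ioc (g.t k) (g.t (k + 1))).indicator (fun _ => g.u k) s

section Integral

variable {U : Type*} [NormedAddCommGroup U] [InnerProductSpace ℝ U]
  {V : Type*} [NormedAddCommGroup V] [InnerProductSpace ℝ V]
  {Ω : Type*} {mΩ : MeasurableSpace Ω} {ℱ : Filtration ℝ≥0 mΩ} {P : Measure Ω}

/-- The integral `∑_{k < n} (L (t (k+1)) - L (t k)) (u k)` of a step function. -/
def CylindricalLevyProcess.stepIntegral (L : CylindricalLevyProcess U ℱ P)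
    (g : StepFunction U) : Ω →ₘ[P] ℝ :=
  ∑ k ∈ Finset.range g.n, (L.toFun (g.t (k + 1)) (g.u k) - L.toFun (g.t k) (g.u k))

/-- `X = ∫₀ᵀ g(s) dL(s)` for a `U`-valued integrand `g`: there is a uniformly bounded sequence of
step functions on `[0, T]` which converges to `g` Lebesgue almost everywhere on `[0, T]` and whose
integrals converge to `X` in probability. (The limit `X` is then almost surely unique and does not
depend on the sequence. If `g` is regulated, any step functions converging uniformly may be used.
The larger class of integrands is needed for `g = 1_A h` with `h` regulated and `A` Borel.) -/
def CylindricalLevyProcess.IsIntegral (L : CylindricalLevyProcess U ℱ P)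
    (T : ℝ≥0) (g : ℝ≥0 → U) (X : Ω → ℝ) : Prop :=
  ∃ (G : ℕ → StepFunction U) (C : ℝ),
    (∀ m, (G m).t (G m).n ≤ T) ∧
    (∀ m s, ‖(G m).eval s‖ ≤ C) ∧
    (∀ᵐ r ∂(volume.restrict (Icc (0 : ℝ) T)),
      Tendsto (fun m => (G m).eval r.toNNReal) atTop (𝓝 (g r.toNNReal))) ∧
    TendstoInMeasure P (fun (m : ℕ) (ω : Ω) => L.stepIntegral (G m) ω) atTop X

variable [CompleteSpace U] [CompleteSpace V]

/-- `I = ∫₀ᵀ 1_A(s) f(s) dL(s)` as a genuine `V`-valued random variable: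
`⟨I, v⟩ = ∫₀ᵀ 1_A(s) f(s)^* v dL(s)` for all `v`. -/
def CylindricalLevyProcess.IsStochasticIntegral (L : CylindricalLevyProcess U ℱ P)
    (T : ℝ≥0) (A : Set ℝ≥0) (f : ℝ≥0 → U →L[ℝ] V) (I : Ω →ₘ[P] V) : Prop :=
  ∀ v : V, L.IsIntegral T (A.indicator fun s => (f s).adjoint v) (fun ω => ⟪I ω, v⟫_ℝ)

/-- `f` is stochastically integrable on `[0, T]` with respect to `L`: for every Borel set
`A ⊆ [0, T]` the integral of `1_A f` exists as a genuine `V`-valued random variable. -/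
def CylindricalLevyProcess.StochasticallyIntegrable (L : CylindricalLevyProcess U ℱ P)
    (T : ℝ≥0) (f : ℝ≥0 → U →L[ℝ] V) : Prop :=
  ∀ A : Set ℝ≥0, MeasurableSet A → A ⊆ Icc 0 T →
    ∃ I : Ω →ₘ[P] V, L.IsStochasticIntegral T A f I

open Classical in
/-- The stochastic integral `∫₀ᵗ f(s) dL(s)` (by convention `0` if it does not exist). -/
def CylindricalLevyProcess.stochasticIntegral (L : CylindricalLevyProcess U ℱ P)
    (t : ℝ≥0) (f : ℝ≥0 → U →L[ℝ] V) : Ω →ₘ[P] V :=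
  if h : ∃ I : Ω →ₘ[P] V, L.IsStochasticIntegral t (Icc 0 t) f I then h.choose else 0

variable [MeasurableSpace V] [BorelSpace V] [IsProbabilityMeasure P]

/-- `ν_t`, the law of `∫₀ᵗ T(s) B dL(s)` on the Borel sets of `V`. -/
def CylindricalLevyProcess.convolutionLaw (L : CylindricalLevyProcess U ℱ P)
    (T : C0Semigroup V) (B : U →L[ℝ] V) (t : ℝ≥0) : ProbabilityMeasure V :=
  ⟨P.map (L.stochasticIntegral t fun s => (T.toFun s).comp B),
    Measure.isProbabilityMeasure_map (AEEqFun.aemeasurable _)⟩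

/-- `ν` is a stationary measure for `Y(t) = T(t) Y₀ + ∫₀ᵗ T(t - s) B dL(s)`: one has
`ν = (T_t ν) * ν_t` for all `t ≥ 0`, where `T_t ν = ν ∘ T(t)⁻¹`. -/
def CylindricalLevyProcess.IsStationaryMeasure (L : CylindricalLevyProcess U ℱ P)
    (T : C0Semigroup V) (B : U →L[ℝ] V) (ν : ProbabilityMeasure V) : Prop :=
  ∀ t : ℝ≥0, (ν : Measure V) =
    ((ν : Measure V).map (T.toFun t)) ∗ (L.convolutionLaw T B t : Measure V)

end Integral

end

/-! Everything is computed with characteristic functions. By independent stationary increments, `E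
exp(i L(t)u) = exp(t Ψ(u))` for a Lévy symbol `Ψ`. It is continuous and bounded on balls, so
dominated convergence along step functions gives `ν_t` the characteristic function `v ↦ exp ∫₀ᵗ
Ψ(B*T*(r)v) dr` (`charFun_convolutionLaw`). This needs the integral to exist on all of `[0, t]`.
Since joint laws of step integrals are invariant under time shifts, integrals on `[0, s]` and `[0,
t]` can be glued to one on `[0, s + t]` (`exists_isStochasticIntegral_add`).

Splitting the exponent at `s` gives `ν_{s+t} = T_s ν_t * ν_s`, and `t → ∞` yields (a).

For (b), `λ = T_n λ * ν_n` for every `n`. The `ν_n` converge and are therefore tight, which forces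
the cofactors `T_n λ` to be tight. By Prokhorov's theorem they have a limit point `β` with `λ = β *
ν`. Comparing the stationarity of `λ` and of `ν` gives `T_s β * ν = λ` for all `s`. Cancelling `ν`
would require its characteristic function to have no zeros; instead `T_s β` is averaged over `s ∈
[0, n + 1]`. The averages are again cofactors of `ν`, hence tight, and their limit points are
invariant (`exists_invariant_cofactor`). -/

/-! ### Exponential functions and convergence in probability -/

/-- A continuous function with `f 0 = 1` has a nonzero integral over some `[0, δ]`. -/
theorem exists_intervalIntegral_ne_zero {f : ℝ → ℂ} (hf : Continuous f) (h0 : f 0 = 1) :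
    ∃ δ : ℝ, 0 < δ ∧ (∫ s in (0 : ℝ)..δ, f s) ≠ 0 := by
  by_contra! hcon
  -- If all these integrals vanished, the primitive would have both right derivatives `1` and `0` at
  -- `0`.
  have h1 : HasDerivWithinAt (fun x => ∫ s in (0 : ℝ)..x, f s) 1 (Ioi 0) 0 := by
    have := (intervalIntegral.integral_hasDerivAt_right (hf.intervalIntegrable 0 0)
      (hf.stronglyMeasurableAtFilter _ _) hf.continuousAt).hasDerivWithinAt (s := Ioi 0)
    rwa [h0] at this
  have h2 : HasDerivWithinAt (fun x => ∫ s in (0 : ℝ)..x, f s) 0 (Ioi 0) 0 := by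
    refine (hasDerivWithinAt_const (0 : ℝ) (Ioi 0) (0 : ℂ)).congr (fun x hx => hcon x hx) ?_
    simp
  exact one_ne_zero ((uniqueDiffWithinAt_Ioi (0 : ℝ)).eq_deriv _ h1 h2)

open Complex in
/-- A continuous one-parameter semigroup of complex numbers is exponential. -/
theorem exists_eq_exp_of_continuous_of_map_add {f : ℝ → ℂ} (hf : Continuous f) (h0 : f 0 = 1)
    (hadd : ∀ s t : ℝ, 0 ≤ s → 0 ≤ t → f (s + t) = f s * f t) :
    ∃ c : ℂ, ∀ t : ℝ, 0 ≤ t → f t = exp (t * c) := by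
  have hF : ∀ x, HasDerivAt (fun x => ∫ s in (0 : ℝ)..x, f s) (f x) x := fun x =>
    intervalIntegral.integral_hasDerivAt_right (hf.intervalIntegrable _ _)
      (hf.stronglyMeasurableAtFilter _ _) hf.continuousAt
  obtain ⟨δ, hδ, hc⟩ := exists_intervalIntegral_ne_zero hf h0
  set c := ∫ s in (0 : ℝ)..δ, f s with hc_def
  -- Integrating `f (t + s) = f t * f s` over `s ∈ [0, δ]` expresses `f` through its primitive, so
  -- mere continuity upgrades to differentiability.
  have hshift : ∀ t : ℝ, 0 ≤ t →
      f t = ((∫ s in (0 : ℝ)..(t + δ), f s) - ∫ s in (0 : ℝ)..t, f s) / c := by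
    intro t ht
    rw [eq_div_iff hc, intervalIntegral.integral_interval_sub_left (hf.intervalIntegrable _ _)
      (hf.intervalIntegrable _ _), hc_def, ← intervalIntegral.integral_const_mul]
    have : ∫ s in (0 : ℝ)..δ, f t * f s = ∫ s in (0 : ℝ)..δ, f (t + s) := by
      refine intervalIntegral.integral_congr fun s hs => ?_
      rw [uIcc_of_le hδ.le] at hs
      exact (hadd t s ht hs.1).symm
    rw [this, intervalIntegral.integral_comp_add_left (fun s => f s) t]
    simp
  refine ⟨(f δ - 1) / c, fun t ht => ?_⟩
  set a := (f δ - 1) / c with ha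
  have hderiv : ∀ x : ℝ, 0 ≤ x → HasDerivWithinAt f (a * f x) (Ici x) x := by
    intro x hx
    have h1 : HasDerivAt
        (fun t => ((∫ s in (0 : ℝ)..(t + δ), f s) - ∫ s in (0 : ℝ)..t, f s) / c)
        ((f (x + δ) - f x) / c) x := by
      refine HasDerivAt.div_const (HasDerivAt.sub ?_ (hF x)) c
      exact (hF (x + δ)).comp_add_const x δ
    have h2 : (f (x + δ) - f x) / c = a * f x := by
      rw [hadd x δ hx hδ.le, ha]; ring
    rw [h2] at h1
    exact h1.hasDerivWithinAt.congr (fun y hy => hshift y (hx.trans hy)) (hshift x hx)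
  have hconst := constant_of_has_deriv_right_zero (a := 0) (b := t)
    (f := fun x : ℝ => f x * exp (-(x * a))) (by fun_prop) (fun x hx => by
      have hE : HasDerivAt (fun x : ℝ => exp (-((x : ℂ) * a))) (exp (-(x * a)) * (-(1 * a))) x := by
        have : HasDerivAt (fun x : ℝ => (x : ℂ)) 1 x := ofRealCLM.hasDerivAt
        exact ((this.mul_const a).neg).cexp
      have := (hderiv x hx.1).mul hE.hasDerivWithinAt
      rwa [show a * f x * exp (-(x * a)) + f x * (exp (-(x * a)) * (-(1 * a))) = 0 by ring]
        at this) t ⟨ht, le_rfl⟩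
  simp only [h0, ofReal_zero, zero_mul, neg_zero, exp_zero, mul_one] at hconst
  rw [exp_neg] at hconst
  have := exp_ne_zero ((t : ℂ) * a)
  field_simp at hconst
  exact hconst

/-- Every subsequence has a further subsequence converging almost everywhere, to which dominated
convergence applies with bound `1`. -/
theorem MeasureTheory.TendstoInMeasure.tendsto_integral_exp {Ω ι : Type*} {mΩ : MeasurableSpace Ω}
    {P : Measure Ω} [IsFiniteMeasure P] {l : Filter ι} [l.IsCountablyGenerated]
    {f : ι → Ω → ℝ} {g : Ω → ℝ} (hf : ∀ i, AEStronglyMeasurable (f i) P)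
    (h : TendstoInMeasure P f l g) :
    Tendsto (fun i => ∫ ω, Complex.exp (f i ω * Complex.I) ∂P) l
      (𝓝 (∫ ω, Complex.exp (g ω * Complex.I) ∂P)) := by
  refine tendsto_of_subseq_tendsto fun ns hns => ?_
  obtain ⟨ms, -, hms⟩ := (h.comp hns).exists_seq_tendsto_ae
  refine ⟨ms, tendsto_integral_of_dominated_convergence (fun _ => 1) (fun n => ?_)
    (integrable_const _) (fun n => ae_of_all _ fun ω => ?_) ?_⟩
  · exact (by fun_prop : Continuous fun x : ℝ =>
      Complex.exp (x * Complex.I)).comp_aestronglyMeasurable (hf _)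
  · rw [Complex.norm_exp_ofReal_mul_I]
  · filter_upwards [hms] with ω hω
    exact (by fun_prop : Continuous fun x : ℝ =>
      Complex.exp (x * Complex.I)).continuousAt.tendsto.comp hω

/-! ### The Lévy symbol -/

namespace CylindricalLevyProcess

variable {U : Type*} [NormedAddCommGroup U] [InnerProductSpace ℝ U]
  {Ω : Type*} {mΩ : MeasurableSpace Ω} {ℱ : Filtration ℝ≥0 mΩ} {P : Measure Ω}

/-- The characteristic function of `L t u` at `1`. -/
noncomputable def chf (L : CylindricalLevyProcess U ℱ P) (t : ℝ≥0) (u : U) : ℂ :=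
  ∫ ω, Complex.exp (L.toFun t u ω * Complex.I) ∂P

theorem adapted (L : CylindricalLevyProcess U ℱ P) {s t : ℝ≥0} (hst : s ≤ t) (u : U) :
    AEStronglyMeasurable[ℱ t] (L.toFun s u : Ω → ℝ) P := by
  have h := (L.levy 1 fun _ => u).adapted s
  exact ((continuous_apply (0 : Fin 1)).comp_aestronglyMeasurable h).mono (ℱ.mono hst)

/-- The increment is independent of `ℱ s` and distributed as `L (t - s) u`. Adaptedness holds only
up to null sets, so independence is used for the measurable version of `Y`. -/
theorem integral_mul_exp_increment [IsProbabilityMeasure P] (L : CylindricalLevyProcess U ℱ P)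
    {s t : ℝ≥0} (hst : s ≤ t) (u : U) {Y : Ω → ℂ} (hY : AEStronglyMeasurable[ℱ s] Y P) :
    ∫ ω, Y ω * Complex.exp ((L.toFun t u ω - L.toFun s u ω : ℝ) * Complex.I) ∂P =
      (∫ ω, Y ω ∂P) * L.chf (t - s) u := by
  have hL := L.levy 1 fun _ => u
  have hmeas : ∀ t : ℝ≥0, Measurable fun ω => L.toFun t u ω :=
    fun t => (AEEqFun.stronglyMeasurable _).measurable
  have hind := hL.indep_increments s t hst
  set D : Ω → ℝ := fun ω => L.toFun t u ω - L.toFun s u ω with hD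
  have hDm : Measurable D := (hmeas t).sub (hmeas s)
  have hDle : MeasurableSpace.comap D inferInstance ≤ MeasurableSpace.comap
      ((fun ω (_ : Fin 1) => L.toFun t u ω) - fun ω (_ : Fin 1) => L.toFun s u ω)
      inferInstance := by
    rintro A ⟨B, hB, rfl⟩
    exact ⟨(fun x : Fin 1 → ℝ => x 0) ⁻¹' B, measurable_pi_apply 0 hB, rfl⟩
  have hYm : Measurable[ℱ s] (hY.mk Y) := hY.stronglyMeasurable_mk.measurable
  have hI : IndepFun (hY.mk Y) D P := by
    rw [IndepFun_iff_Indep]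
    exact (indep_of_indep_of_le_left (indep_of_indep_of_le_right hind hYm.comap_le) hDle).symm
  have hexp : Measurable fun x : ℝ => Complex.exp (x * Complex.I) := by fun_prop
  have hE : ∫ ω, Complex.exp (D ω * Complex.I) ∂P = L.chf (t - s) u := by
    have h1 := hL.stationary_increments s (t - s)
    have h2 := (h1.comp (hexp.comp (measurable_pi_apply (0 : Fin 1)))).integral_eq
    rw [add_tsub_cancel_of_le hst] at h2
    exact h2
  have hI2 : IndepFun (hY.mk Y) (fun ω => Complex.exp (D ω * Complex.I)) P :=
    hI.comp measurable_id hexp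
  have hYD : (fun ω => Y ω * Complex.exp (D ω * Complex.I)) =ᵐ[P]
      fun ω => hY.mk Y ω * Complex.exp (D ω * Complex.I) :=
    hY.ae_eq_mk.mono fun ω hω => by simp only; rw [← hω]
  rw [integral_congr_ae hYD, hI2.integral_fun_mul_eq_mul_integral, hE,
    integral_congr_ae hY.ae_eq_mk]
  · exact (hYm.mono (ℱ.le s) le_rfl).aestronglyMeasurable
  · exact (hexp.comp hDm).aestronglyMeasurable

theorem toFun_zero_ae (L : CylindricalLevyProcess U ℱ P) (u : U) :
    (L.toFun 0 u : Ω → ℝ) =ᵐ[P] 0 := by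
  filter_upwards [(L.levy 1 fun _ => u).zero] with ω hω
  exact congrFun hω 0

theorem chf_zero_left [IsProbabilityMeasure P] (L : CylindricalLevyProcess U ℱ P) (u : U) :
    L.chf 0 u = 1 := by
  rw [chf, integral_congr_ae (g := fun _ => (1 : ℂ))]
  · simp
  · filter_upwards [L.toFun_zero_ae u] with ω hω
    simp [hω]

theorem chf_zero_right [IsProbabilityMeasure P] (L : CylindricalLevyProcess U ℱ P) (t : ℝ≥0) :
    L.chf t 0 = 1 := by
  rw [chf, integral_congr_ae (g := fun _ => (1 : ℂ))]
  · simp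
  · rw [_root_.map_zero]
    filter_upwards [AEEqFun.coeFn_zero (μ := P) (β := ℝ)] with ω hω
    simp [hω]

theorem chf_add [IsProbabilityMeasure P] (L : CylindricalLevyProcess U ℱ P) (s t : ℝ≥0) (u : U) :
    L.chf (s + t) u = L.chf s u * L.chf t u := by
  have h := L.integral_mul_exp_increment (le_self_add : s ≤ s + t) u
    (Y := fun ω => Complex.exp (L.toFun s u ω * Complex.I))
    ((by fun_prop : Continuous fun x : ℝ =>
      Complex.exp (x * Complex.I)).comp_aestronglyMeasurable (L.adapted le_rfl u))
  rw [add_tsub_cancel_left] at h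
  refine Eq.trans ?_ h
  refine integral_congr_ae (ae_of_all _ fun ω => ?_)
  simp only
  rw [← Complex.exp_add]
  congr 1
  push_cast
  ring

theorem norm_chf_le_one [IsProbabilityMeasure P] (L : CylindricalLevyProcess U ℱ P) (t : ℝ≥0)
    (u : U) : ‖L.chf t u‖ ≤ 1 := by
  refine (norm_integral_le_of_norm_le_const (C := 1) (ae_of_all _ fun ω => ?_)).trans (by simp)
  rw [Complex.norm_exp_ofReal_mul_I]

theorem continuous_chf_left [IsProbabilityMeasure P] (L : CylindricalLevyProcess U ℱ P) (u : U) :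
    Continuous fun t => L.chf t u := by
  refine continuous_iff_continuousAt.2 fun s => ?_
  refine TendstoInMeasure.tendsto_integral_exp (fun t => AEEqFun.aestronglyMeasurable _) ?_
  intro ε hε
  refine tendsto_of_tendsto_of_tendsto_of_le_of_le tendsto_const_nhds
    ((L.levy 1 fun _ => u).stochastically_continuous s ε hε) (fun _ => zero_le) fun t => ?_
  exact measure_mono fun ω hω => le_trans hω
    (edist_le_pi_edist (fun _ : Fin 1 => L.toFun t u ω) (fun _ => L.toFun s u ω) 0)

theorem continuous_chf_right [IsProbabilityMeasure P] (L : CylindricalLevyProcess U ℱ P)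
    (t : ℝ≥0) : Continuous fun u => L.chf t u :=
  continuous_iff_continuousAt.2 fun u =>
    (L.continuous_toFun t u).tendsto_integral_exp fun _ => AEEqFun.aestronglyMeasurable _

theorem exists_exponent [IsProbabilityMeasure P] (L : CylindricalLevyProcess U ℱ P) (u : U) :
    ∃ c : ℂ, ∀ t : ℝ≥0, L.chf t u = Complex.exp (t * c) := by
  obtain ⟨c, hc⟩ := exists_eq_exp_of_continuous_of_map_add
    (f := fun r => L.chf r.toNNReal u) ((L.continuous_chf_left u).comp continuous_real_toNNReal)
    (by simp [chf_zero_left]) (fun s t hs ht => by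
      rw [Real.toNNReal_add hs ht, chf_add])
  exact ⟨c, fun t => by simpa using hc t t.2⟩

/-- The Lévy symbol: `E exp(i L(t) u) = exp(t Ψ(u))`. -/
noncomputable def symbol [IsProbabilityMeasure P] (L : CylindricalLevyProcess U ℱ P) (u : U) : ℂ :=
  (L.exists_exponent u).choose

theorem chf_eq_exp [IsProbabilityMeasure P] (L : CylindricalLevyProcess U ℱ P) (t : ℝ≥0) (u : U) :
    L.chf t u = Complex.exp (t * L.symbol u) :=
  (L.exists_exponent u).choose_spec t

theorem hasDerivAt_exp_symbol [IsProbabilityMeasure P] (L : CylindricalLevyProcess U ℱ P) (u : U)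
    (x : ℝ) : HasDerivAt (fun r : ℝ => Complex.exp (r * L.symbol u))
      (Complex.exp (x * L.symbol u) * L.symbol u) x := by
  have : HasDerivAt (fun x : ℝ => (x : ℂ)) 1 x := Complex.ofRealCLM.hasDerivAt
  simpa using (this.mul_const (L.symbol u)).cexp

/-- The symbol is a derivative at `0`, which makes it unique and lets estimates of `chf` pass to it.
-/
theorem tendsto_slope_chf [IsProbabilityMeasure P] (L : CylindricalLevyProcess U ℱ P) (u : U) :
    Tendsto (fun r : ℝ => r⁻¹ • (L.chf r.toNNReal u - 1)) (𝓝[>] 0) (𝓝 (L.symbol u)) := by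
  have h := (hasDerivAt_iff_tendsto_slope_zero.1 (L.hasDerivAt_exp_symbol u 0)).mono_left
    (nhdsWithin_mono 0 (fun x (hx : 0 < x) => hx.ne') : 𝓝[>] (0 : ℝ) ≤ 𝓝[≠] 0)
  simp only [zero_add, Complex.ofReal_zero, zero_mul, Complex.exp_zero, one_mul] at h
  refine h.congr' ?_
  filter_upwards [self_mem_nhdsWithin] with r hr
  rw [chf_eq_exp, Real.coe_toNNReal r (le_of_lt hr)]

theorem symbol_zero [IsProbabilityMeasure P] (L : CylindricalLevyProcess U ℱ P) :
    L.symbol 0 = 0 := by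
  refine tendsto_nhds_unique (L.tendsto_slope_chf 0) ?_
  simp [chf_zero_right]

/-- With `z = exp(iX)`, `z² - 1 = (z - 1)² + 2(z - 1)`. As `|z| = 1`, `|z - 1|² = -2 Re(z - 1)`, so
each of the two terms contributes at most twice `‖E z - 1‖`. -/
theorem norm_chf_two_smul_sub_one_le [IsProbabilityMeasure P] (L : CylindricalLevyProcess U ℱ P)
    (t : ℝ≥0) (u : U) : ‖L.chf t ((2 : ℝ) • u) - 1‖ ≤ 4 * ‖L.chf t u - 1‖ := by
  set X : Ω → ℝ := fun ω => L.toFun t u ω with hX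
  have hXm : AEStronglyMeasurable X P := AEEqFun.aestronglyMeasurable _
  have hcont : Continuous fun x : ℝ => Complex.exp (x * Complex.I) := by fun_prop
  have hint : Integrable (fun ω => Complex.exp (X ω * Complex.I)) P :=
    Integrable.of_bound (hcont.comp_aestronglyMeasurable hXm) 1
      (ae_of_all _ fun ω => (Complex.norm_exp_ofReal_mul_I _).le)
  have hint1 : Integrable (fun ω => Complex.exp (X ω * Complex.I) - 1) P :=
    hint.sub (integrable_const _)
  have hone : L.chf t u - 1 = ∫ ω, (Complex.exp (X ω * Complex.I) - 1) ∂P := by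
    rw [integral_sub hint (integrable_const _)]; simp [chf, hX]
  have hnorm : ∀ x : ℝ, ‖Complex.exp (x * Complex.I) - 1‖ ^ 2 =
      -(2 * (Complex.exp (x * Complex.I) - 1).re) := by
    intro x
    rw [← Complex.normSq_eq_norm_sq, Complex.normSq_apply]
    simp only [Complex.sub_re, Complex.sub_im, Complex.exp_ofReal_mul_I_re,
      Complex.exp_ofReal_mul_I_im, Complex.one_re, Complex.one_im]
    nlinarith [Real.sin_sq_add_cos_sq x]
  have hsq : Integrable (fun ω => (Complex.exp (X ω * Complex.I) - 1) ^ 2) P := by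
    refine Integrable.of_bound ((hcont.sub continuous_const |>.pow 2).comp_aestronglyMeasurable hXm)
      4 (ae_of_all _ fun ω => ?_)
    rw [norm_pow, hnorm, Complex.sub_re, Complex.exp_ofReal_mul_I_re, Complex.one_re]
    linarith [Real.neg_one_le_cos (X ω)]
  have htwo : L.chf t ((2 : ℝ) • u) - 1 =
      (∫ ω, (Complex.exp (X ω * Complex.I) - 1) ^ 2 ∂P) + 2 * (L.chf t u - 1) := by
    rw [hone, ← integral_const_mul, ← integral_add hsq (hint1.const_mul 2), chf]
    have h2 : ∫ ω, Complex.exp (L.toFun t ((2 : ℝ) • u) ω * Complex.I) ∂P =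
        ∫ ω, ((Complex.exp (X ω * Complex.I) - 1) ^ 2 + 2 * (Complex.exp (X ω * Complex.I) - 1)
          + 1) ∂P := by
      refine integral_congr_ae ?_
      rw [_root_.map_smul]
      filter_upwards [AEEqFun.coeFn_smul (2 : ℝ) (L.toFun t u)] with ω hω
      rw [hω, Pi.smul_apply, smul_eq_mul, show (((2 * L.toFun t u ω : ℝ) : ℂ) * Complex.I) =
        X ω * Complex.I + X ω * Complex.I by rw [hX]; push_cast; ring, Complex.exp_add]
      ring
    have h3 := integral_add (hsq.add (hint1.const_mul 2)) (integrable_const (μ := P) (1 : ℂ))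
    simp only [Pi.add_apply] at h3
    rw [h2, h3]
    simp
  have hbound : ‖∫ ω, (Complex.exp (X ω * Complex.I) - 1) ^ 2 ∂P‖ ≤ 2 * ‖L.chf t u - 1‖ := by
    calc ‖∫ ω, (Complex.exp (X ω * Complex.I) - 1) ^ 2 ∂P‖
        ≤ ∫ ω, ‖(Complex.exp (X ω * Complex.I) - 1) ^ 2‖ ∂P := norm_integral_le_integral_norm _
      _ = ∫ ω, -(2 * (Complex.exp (X ω * Complex.I) - 1).re) ∂P := by
          simp_rw [norm_pow, hnorm]
      _ = -(2 * (L.chf t u - 1).re) := by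
          rw [integral_neg, integral_const_mul, hone]
          congr 2
          exact integral_re hint1
      _ ≤ 2 * ‖L.chf t u - 1‖ := by
          have := (abs_le.1 (Complex.abs_re_le_norm (L.chf t u - 1))).1
          linarith
  rw [htwo]
  refine (norm_add_le _ _).trans ?_
  rw [norm_mul, Complex.norm_ofNat]
  linarith

theorem norm_symbol_two_smul_le [IsProbabilityMeasure P] (L : CylindricalLevyProcess U ℱ P)
    (u : U) : ‖L.symbol ((2 : ℝ) • u)‖ ≤ 4 * ‖L.symbol u‖ := by
  refine le_of_tendsto_of_tendsto (L.tendsto_slope_chf _).norm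
    ((L.tendsto_slope_chf u).norm.const_mul 4) ?_
  filter_upwards with r
  rw [norm_smul, norm_smul]
  nlinarith [L.norm_chf_two_smul_sub_one_le r.toNNReal u, norm_nonneg r⁻¹]

/-- Integrating the derivative of `exp(rΨ(u))` gives `chf δ u - 1 = Ψ(u) ∫₀^δ chf r u dr`. Near a
given `u` some `δ` makes the integral nonzero, and dividing avoids any choice of logarithm. -/
theorem continuous_symbol [IsProbabilityMeasure P] (L : CylindricalLevyProcess U ℱ P) :
    Continuous L.symbol := by
  have hfc : ∀ u, Continuous fun r : ℝ => L.chf r.toNNReal u := fun u =>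
    (L.continuous_chf_left u).comp continuous_real_toNNReal
  have hdc : ∀ δ : ℝ, Continuous fun u => ∫ r in (0 : ℝ)..δ, L.chf r.toNNReal u := fun δ =>
    intervalIntegral.continuous_of_dominated_interval (bound := fun _ => 1)
      (fun u => (hfc u).aestronglyMeasurable)
      (fun u => ae_of_all _ fun r _ => L.norm_chf_le_one _ _) (by simp)
      (ae_of_all _ fun r _ => L.continuous_chf_right _)
  have heq : ∀ (δ : ℝ) (u : U), 0 ≤ δ → L.chf δ.toNNReal u - 1 =
      (∫ r in (0 : ℝ)..δ, L.chf r.toNNReal u) * L.symbol u := by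
    intro δ u hδ
    have h := intervalIntegral.integral_eq_sub_of_hasDerivAt (a := 0) (b := δ)
      (fun x _ => L.hasDerivAt_exp_symbol u x)
      (Continuous.intervalIntegrable (by fun_prop) _ _)
    rw [intervalIntegral.integral_mul_const] at h
    rw [chf_eq_exp, Real.coe_toNNReal δ hδ]
    simp only [Complex.ofReal_zero, zero_mul, Complex.exp_zero] at h
    rw [← h]
    congr 1
    refine intervalIntegral.integral_congr fun r hr => ?_
    rw [uIcc_of_le hδ] at hr
    simp only [chf_eq_exp, Real.coe_toNNReal r hr.1]
  refine continuous_iff_continuousAt.2 fun u => ?_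
  obtain ⟨δ, hδ, hne⟩ := exists_intervalIntegral_ne_zero (hfc u) (by simp [chf_zero_left])
  have hquot : ContinuousAt
      (fun w => (L.chf δ.toNNReal w - 1) / ∫ r in (0 : ℝ)..δ, L.chf r.toNNReal w) u :=
    ((L.continuous_chf_right _).sub continuous_const).continuousAt.div (hdc δ).continuousAt hne
  refine hquot.congr ?_
  filter_upwards [(hdc δ).continuousAt.eventually_ne hne] with w hw
  rw [heq δ w hδ.le, mul_div_cancel_left₀ _ hw]

/-- Balls need not be compact, so continuity alone is not enough. It bounds the symbol near `0`, and
each doubling of the radius costs a factor `4`. -/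
theorem exists_norm_symbol_le [IsProbabilityMeasure P] (L : CylindricalLevyProcess U ℱ P)
    (C : ℝ) : ∃ M : ℝ, ∀ u, ‖u‖ ≤ C → ‖L.symbol u‖ ≤ M := by
  have h0 : ∀ᶠ u in 𝓝 (0 : U), ‖L.symbol u‖ < 1 :=
    L.continuous_symbol.norm.continuousAt.eventually_lt continuousAt_const (by simp [symbol_zero])
  obtain ⟨δ, hδ, hball⟩ := Metric.eventually_nhds_iff.1 h0
  have hn : ∀ (n : ℕ) (u : U), ‖u‖ < 2 ^ n * δ → ‖L.symbol u‖ ≤ 4 ^ n := by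
    intro n
    induction n with
    | zero => intro u hu; simpa using (hball (by simpa using hu)).le
    | succ n ih =>
      intro u hu
      have h := L.norm_symbol_two_smul_le ((2 : ℝ)⁻¹ • u)
      rw [smul_smul, mul_inv_cancel₀ two_ne_zero, one_smul] at h
      have := ih ((2 : ℝ)⁻¹ • u) (by
        rw [norm_smul, norm_inv, Real.norm_ofNat, pow_succ] at *; linarith)
      rw [pow_succ]; linarith
  obtain ⟨n, hn'⟩ := pow_unbounded_of_one_lt (C / δ) (one_lt_two : (1 : ℝ) < 2)
  exact ⟨4 ^ n, fun u hu => hn n u (hu.trans_lt ((div_lt_iff₀ hδ).1 hn'))⟩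

end CylindricalLevyProcess

/-! ### Step functions and refinement of partitions -/

namespace StepFunction

variable {U : Type*}

/-- `F` need not be additive: the intervals are disjoint, so at most one summand is nonzero. -/
theorem map_eval {W : Type*} [AddCommMonoid U] [AddCommMonoid W] (F : U → W) (hF : F 0 = 0)
    (G : StepFunction U) (s : ℝ≥0) :
    F (G.eval s) = ∑ k ∈ Finset.range G.n,
      (Ioc (G.t k) (G.t (k + 1))).indicator (fun _ => F (G.u k)) s := by
  have hmono := G.mono
  rw [eval]
  induction G.n with
  | zero => simpa using hF
  | succ n ih =>
    rw [Finset.sum_range_succ, Finset.sum_range_succ]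
    by_cases hs : s ∈ Ioc (G.t n) (G.t (n + 1))
    · have hnot : ∀ k ∈ Finset.range n, s ∉ Ioc (G.t k) (G.t (k + 1)) := fun k hk hk' =>
        absurd (hk'.2.trans (hmono (Finset.mem_range.1 hk))) (not_le.2 hs.1)
      rw [Finset.sum_eq_zero fun k hk => indicator_of_notMem (hnot k hk) _,
        Finset.sum_eq_zero fun k hk => indicator_of_notMem (hnot k hk) _]
      simp [hs]
    · simp only [indicator_of_notMem hs, add_zero]
      exact ih

variable [AddCommGroup U]

/-- This has the same shape as the step integral, so `sum_refineCoeff` handles values and integrals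
alike. -/
theorem eval_eq_sum_sub (G : StepFunction U) (s : ℝ≥0) :
    G.eval s = ∑ k ∈ Finset.range G.n,
      ((if s ≤ G.t (k + 1) then G.u k else 0) - if s ≤ G.t k then G.u k else 0) := by
  refine Finset.sum_congr rfl fun k _ => ?_
  have := G.mono (Nat.le_succ k)
  by_cases h1 : s ≤ G.t k
  · simp [h1, h1.trans this]
  · by_cases h2 : s ≤ G.t (k + 1) <;> simp [h1, h2, indicator, not_le.1 h1]

theorem eval_eq_zero_of_lt (G : StepFunction U) {s : ℝ≥0} (hs : G.t G.n < s) : G.eval s = 0 :=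
  Finset.sum_eq_zero fun _ hk => indicator_of_notMem
    (fun h => absurd (h.2.trans (G.mono (Finset.mem_range.1 hk))) (not_le.2 hs)) _

@[simp]
theorem eval_zero (G : StepFunction U) : G.eval 0 = 0 :=
  Finset.sum_eq_zero fun _ _ => indicator_of_notMem (fun h => absurd h.1 not_lt_zero) _

/-- Translation of a step function to the right. -/
@[simps]
def shift (s : ℝ≥0) (G : StepFunction U) : StepFunction U where
  n := G.n
  t k := s + G.t k
  mono _ _ h := add_le_add_right (G.mono h) s
  u := G.u

theorem eval_shift (s : ℝ≥0) (G : StepFunction U) (r : ℝ≥0) :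
    (G.shift s).eval r = G.eval (r - s) := by
  refine Finset.sum_congr rfl fun k _ => ?_
  simp only [shift_t, shift_u, indicator, mem_Ioc, lt_tsub_iff_left, tsub_le_iff_left]

/-- Restriction of a step function to `[0, c]`. -/
@[simps]
def truncate (c : ℝ≥0) (G : StepFunction U) : StepFunction U where
  n := G.n
  t k := min (G.t k) c
  mono _ _ h := min_le_min_right c (G.mono h)
  u := G.u

theorem eval_truncate (c : ℝ≥0) (G : StepFunction U) (r : ℝ≥0) :
    (G.truncate c).eval r = (Iic c).indicator G.eval r := by
  by_cases hr : r ≤ c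
  · rw [indicator_of_mem (mem_Iic.2 hr)]
    refine Finset.sum_congr rfl fun k _ => ?_
    simp [indicator, hr, not_lt.2 hr]
  · rw [indicator_of_notMem (by simpa using hr)]
    exact Finset.sum_eq_zero fun k _ => indicator_of_notMem (fun h => hr (le_min_iff.1 h.2).2) _

/-- Restriction of a step function to `(c, ∞)`. -/
@[simps]
def startAt (c : ℝ≥0) (G : StepFunction U) : StepFunction U where
  n := G.n
  t k := max (G.t k) c
  mono _ _ h := max_le_max_right c (G.mono h)
  u := G.u

theorem eval_startAt (c : ℝ≥0) (G : StepFunction U) (r : ℝ≥0) :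
    (G.startAt c).eval r = (Ioi c).indicator G.eval r := by
  by_cases hr : c < r
  · rw [indicator_of_mem (mem_Ioi.2 hr)]
    refine Finset.sum_congr rfl fun k _ => ?_
    simp [indicator, hr, not_le.2 hr]
  · rw [indicator_of_notMem (by simpa using hr)]
    exact Finset.sum_eq_zero fun k _ =>
      indicator_of_notMem (fun h => hr (max_lt_iff.1 h.1).2) _

/-- Scalar multiple of a step function. -/
@[simps]
def smul {R : Type*} [SMul R U] (c : R) (G : StepFunction U) : StepFunction U where
  n := G.n
  t := G.t
  mono := G.mono
  u k := c • G.u k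

theorem eval_smul {R : Type*} [Monoid R] [DistribMulAction R U] (c : R) (G : StepFunction U)
    (r : ℝ≥0) : (G.smul c).eval r = c • G.eval r :=
  ((map_eval (fun u => c • u) (smul_zero c) G r)).symm

/-- The coefficients of `G` with respect to a finer partition `t`. -/
noncomputable def refineCoeff (G : StepFunction U) (t : ℕ → ℝ≥0) (j : ℕ) : U :=
  ∑ k ∈ Finset.range G.n, if G.t k ≤ t j ∧ t (j + 1) ≤ G.t (k + 1) then G.u k else 0

theorem sum_refine_interval {W : Type*} [AddCommGroup W] {t : ℕ → ℝ≥0} (ht : Monotone t) {n : ℕ}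
    (f : ℝ≥0 → W) {i i' : ℕ} (hi' : i' ≤ n) (h : t i ≤ t i') :
    (∑ j ∈ Finset.range n, if t i ≤ t j ∧ t (j + 1) ≤ t i' then f (t (j + 1)) - f (t j) else 0) =
      f (t i') - f (t i) := by
  -- Both endpoints are partition points, so no cell straddles them. Clamping to `[t i, t i']` makes
  -- the outside terms vanish and the sum telescope.
  set clamp : ℝ≥0 → ℝ≥0 := fun x => max (t i) (min x (t i')) with hclamp
  have key : ∀ j ∈ Finset.range n,
      (if t i ≤ t j ∧ t (j + 1) ≤ t i' then f (t (j + 1)) - f (t j) else 0) =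
      f (clamp (t (j + 1))) - f (clamp (t j)) := by
    intro j _
    have hj : t j ≤ t (j + 1) := ht (Nat.le_succ j)
    by_cases h1 : t i ≤ t j
    · by_cases h2 : t (j + 1) ≤ t i'
      · simp [hclamp, h1, h2, hj.trans h2, h1.trans hj]
      · have h3 : t i' ≤ t j := by
          by_contra h3
          exact h2 (ht (Nat.succ_le_of_lt (ht.reflect_lt (not_le.1 h3))))
        simp [hclamp, h2, h3, h3.trans hj]
    · have h3 : t (j + 1) ≤ t i := ht (Nat.succ_le_of_lt (ht.reflect_lt (not_le.1 h1)))
      simp [hclamp, h1, h3, hj.trans h3]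
  rw [Finset.sum_congr rfl key, Finset.sum_range_sub fun j => f (clamp (t j))]
  simp [hclamp, ht hi', ht (Nat.zero_le i), h]

theorem sum_refineCoeff {W : Type*} [AddCommGroup W] (G : StepFunction U) {t : ℕ → ℝ≥0}
    (ht : Monotone t) {n : ℕ} (hcover : ∀ k ≤ G.n, ∃ j ≤ n, t j = G.t k) (F : ℝ≥0 → U →+ W) :
    ∑ j ∈ Finset.range n, (F (t (j + 1)) (G.refineCoeff t j) - F (t j) (G.refineCoeff t j)) =
      ∑ k ∈ Finset.range G.n, (F (G.t (k + 1)) (G.u k) - F (G.t k) (G.u k)) := by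
  simp only [refineCoeff, map_sum, ← Finset.sum_sub_distrib]
  rw [Finset.sum_comm]
  refine Finset.sum_congr rfl fun k hk => ?_
  obtain ⟨i, -, hti⟩ := hcover k (Finset.mem_range.1 hk).le
  obtain ⟨i', hi', hti'⟩ := hcover (k + 1) (Finset.mem_range.1 hk)
  rw [← hti, ← hti', ← sum_refine_interval ht (fun s => F s (G.u k)) hi'
    (by rw [hti, hti']; exact G.mono (Nat.le_succ k))]
  refine Finset.sum_congr rfl fun j _ => ?_
  split_ifs <;> simp

theorem exists_monotone_cover (S : Finset ℝ≥0) {T : ℝ≥0} (hS : ∀ x ∈ S, x ≤ T) :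
    ∃ (t : ℕ → ℝ≥0) (n : ℕ), Monotone t ∧ t n ≤ T ∧ ∀ x ∈ S, ∃ j ≤ n, t j = x := by
  have hsort : (S.sort (· ≤ ·)).Pairwise (· ≤ ·) := Finset.pairwise_sort S (· ≤ ·)
  set l := S.sort (· ≤ ·) with hl
  have hle : ∀ x ∈ l, x ≤ T := fun x hx => hS x ((Finset.mem_sort _).1 hx)
  -- The default value `T` past the end of the sorted list keeps the sequence monotone and gives `t
  -- n = T`.
  refine ⟨fun k => l.getD k T, l.length, fun i j hij => ?_,
    (List.getD_eq_default _ _ le_rfl).le, fun x hx => ?_⟩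
  · simp only
    by_cases hj : j < l.length
    · rw [List.getD_eq_getElem _ _ hj, List.getD_eq_getElem _ _ (hij.trans_lt hj)]
      rcases hij.eq_or_lt with rfl | hij'
      · exact le_rfl
      · exact List.pairwise_iff_getElem.1 hsort i j _ hj hij'
    · rw [List.getD_eq_default _ _ (not_lt.1 hj)]
      by_cases hi : i < l.length
      · rw [List.getD_eq_getElem _ _ hi]
        exact hle _ (List.getElem_mem hi)
      · rw [List.getD_eq_default _ _ (not_lt.1 hi)]
  · obtain ⟨j, hj, rfl⟩ := List.mem_iff_getElem.1 ((Finset.mem_sort (· ≤ ·)).2 hx)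
    exact ⟨j, hj.le, List.getD_eq_getElem _ _ hj⟩

end StepFunction

/-! ### Integrals of step functions -/

namespace CylindricalLevyProcess

variable {U : Type*} [NormedAddCommGroup U] [InnerProductSpace ℝ U]
  {Ω : Type*} {mΩ : MeasurableSpace Ω} {ℱ : Filtration ℝ≥0 mΩ} {P : Measure Ω}

theorem stepIntegral_smul (L : CylindricalLevyProcess U ℱ P) (c : ℝ) (G : StepFunction U) :
    L.stepIntegral (G.smul c) = c • L.stepIntegral G := by
  simp [stepIntegral, Finset.smul_sum, smul_sub]

theorem stepIntegral_truncate_add_startAt (L : CylindricalLevyProcess U ℱ P) (c : ℝ≥0)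
    (G : StepFunction U) :
    L.stepIntegral (G.truncate c) + L.stepIntegral (G.startAt c) = L.stepIntegral G := by
  have h : ∀ (a : ℝ≥0) (u : U),
      L.toFun (min a c) u + L.toFun (max a c) u = L.toFun a u + L.toFun c u := by
    intro a u
    rcases le_total a c with h | h
    · rw [min_eq_left h, max_eq_right h]
    · rw [min_eq_right h, max_eq_left h, add_comm]
  simp only [stepIntegral, StepFunction.truncate_n, StepFunction.startAt_n,
    StepFunction.truncate_t, StepFunction.startAt_t, StepFunction.truncate_u,
    StepFunction.startAt_u]
  rw [← Finset.sum_add_distrib]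
  refine Finset.sum_congr rfl fun k _ => ?_
  rw [sub_add_sub_comm, h, h]
  abel

theorem exists_stepFunction_add (L : CylindricalLevyProcess U ℱ P) (G G' : StepFunction U)
    {T : ℝ≥0} (hG : G.t G.n ≤ T) (hG' : G'.t G'.n ≤ T) :
    ∃ H : StepFunction U, H.t H.n ≤ T ∧ (∀ s, H.eval s = G.eval s + G'.eval s) ∧
      L.stepIntegral H = L.stepIntegral G + L.stepIntegral G' := by
  obtain ⟨t, n, ht, hn, hcov⟩ := StepFunction.exists_monotone_cover
    ((Finset.range (G.n + 1)).image G.t ∪ (Finset.range (G'.n + 1)).image G'.t) (T := T) (by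
      simp only [Finset.mem_union, Finset.mem_image, Finset.mem_range, Nat.lt_succ_iff]
      rintro x (⟨k, hk, rfl⟩ | ⟨k, hk, rfl⟩)
      · exact (G.mono hk).trans hG
      · exact (G'.mono hk).trans hG')
  have h1 : ∀ k ≤ G.n, ∃ j ≤ n, t j = G.t k := fun k hk => hcov _ <|
    Finset.mem_union_left _ <| Finset.mem_image_of_mem _ <| Finset.mem_range_succ_iff.2 hk
  have h2 : ∀ k ≤ G'.n, ∃ j ≤ n, t j = G'.t k := fun k hk => hcov _ <|
    Finset.mem_union_right _ <| Finset.mem_image_of_mem _ <| Finset.mem_range_succ_iff.2 hk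
  refine ⟨⟨n, t, ht, fun j => G.refineCoeff t j + G'.refineCoeff t j⟩, hn, fun s => ?_, ?_⟩
  · let F : ℝ≥0 → U →+ U := fun a => if s ≤ a then AddMonoidHom.id U else 0
    have hF : ∀ a u, F a u = if s ≤ a then u else 0 := fun a u => by
      simp only [F]; split_ifs <;> rfl
    rw [StepFunction.eval_eq_sum_sub, StepFunction.eval_eq_sum_sub, StepFunction.eval_eq_sum_sub]
    simp only [← hF, map_add]
    rw [← G.sum_refineCoeff ht h1 F, ← G'.sum_refineCoeff ht h2 F, ← Finset.sum_add_distrib]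
    exact Finset.sum_congr rfl fun k _ => by abel
  · have e1 := G.sum_refineCoeff ht h1 fun a => (L.toFun a).toAddMonoidHom
    have e2 := G'.sum_refineCoeff ht h2 fun a => (L.toFun a).toAddMonoidHom
    simp only [LinearMap.toAddMonoidHom_coe] at e1 e2
    simp only [stepIntegral, map_add]
    rw [← e1, ← e2, ← Finset.sum_add_distrib]
    exact Finset.sum_congr rfl fun k _ => by abel

theorem exists_stepFunction_sum (L : CylindricalLevyProcess U ℱ P) {κ : Type*} (I : Finset κ)
    (c : κ → ℝ) (G : κ → StepFunction U) :
    ∃ H : StepFunction U, (∀ s, H.eval s = ∑ i ∈ I, c i • (G i).eval s) ∧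
      L.stepIntegral H = ∑ i ∈ I, c i • L.stepIntegral (G i) := by
  classical
  induction I using Finset.induction_on with
  | empty => exact ⟨⟨0, 0, monotone_const, 0⟩, by simp [StepFunction.eval], by simp [stepIntegral]⟩
  | insert i I hi ih =>
    obtain ⟨H, h1, h2⟩ := ih
    obtain ⟨H', -, h3, h4⟩ := L.exists_stepFunction_add ((G i).smul (c i)) H
      (le_max_left _ _) (le_max_right _ _)
    refine ⟨H', fun s => ?_, ?_⟩
    · rw [h3, h1, StepFunction.eval_smul, Finset.sum_insert hi]
    · rw [h4, h2, stepIntegral_smul, Finset.sum_insert hi]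

theorem stepIntegral_ae_eq (L : CylindricalLevyProcess U ℱ P) (G : StepFunction U) :
    (L.stepIntegral G : Ω → ℝ) =ᵐ[P] fun ω => ∑ k ∈ Finset.range G.n,
      (L.toFun (G.t (k + 1)) (G.u k) ω - L.toFun (G.t k) (G.u k) ω) := by
  rw [stepIntegral]
  induction G.n with
  | zero =>
    filter_upwards [AEEqFun.coeFn_zero (μ := P) (β := ℝ)] with ω hω
    simp [hω]
  | succ n ih =>
    rw [Finset.sum_range_succ]
    filter_upwards [ih, AEEqFun.coeFn_add (∑ k ∈ Finset.range n,
      (L.toFun (G.t (k + 1)) (G.u k) - L.toFun (G.t k) (G.u k)))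
      (L.toFun (G.t (n + 1)) (G.u n) - L.toFun (G.t n) (G.u n)),
      AEEqFun.coeFn_sub (L.toFun (G.t (n + 1)) (G.u n)) (L.toFun (G.t n) (G.u n))] with ω h1 h2 h3
    rw [h2, Pi.add_apply, h1, h3, Pi.sub_apply, Finset.sum_range_succ]

theorem adapted_sum (L : CylindricalLevyProcess U ℱ P) (G : StepFunction U) (n : ℕ) :
    AEStronglyMeasurable[ℱ (G.t n)] (fun ω => ∑ k ∈ Finset.range n,
      (L.toFun (G.t (k + 1)) (G.u k) ω - L.toFun (G.t k) (G.u k) ω)) P := by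
  have h : ∀ m ≤ n, AEStronglyMeasurable[ℱ (G.t n)] (fun ω => ∑ k ∈ Finset.range m,
      (L.toFun (G.t (k + 1)) (G.u k) ω - L.toFun (G.t k) (G.u k) ω)) P := by
    intro m
    induction m with
    | zero => exact fun _ => by simpa using aestronglyMeasurable_const
    | succ m ih =>
      intro hm
      simp only [Finset.sum_range_succ]
      exact (ih (Nat.le_of_succ_le hm)).add ((L.adapted (G.mono hm) _).sub
        (L.adapted (G.mono (Nat.le_of_succ_le hm)) _))
  exact h n le_rfl

/-- The last increment is independent of the earlier sum, which is measurable at its starting time;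
factors split off one at a time. -/
theorem integral_exp_stepIntegral_eq_prod [IsProbabilityMeasure P]
    (L : CylindricalLevyProcess U ℱ P) (G : StepFunction U) :
    ∫ ω, Complex.exp (L.stepIntegral G ω * Complex.I) ∂P =
      ∏ k ∈ Finset.range G.n, L.chf (G.t (k + 1) - G.t k) (G.u k) := by
  have hae : (fun ω => Complex.exp (L.stepIntegral G ω * Complex.I)) =ᵐ[P] fun ω =>
      Complex.exp ((∑ k ∈ Finset.range G.n,
        (L.toFun (G.t (k + 1)) (G.u k) ω - L.toFun (G.t k) (G.u k) ω) : ℝ) * Complex.I) :=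
    (L.stepIntegral_ae_eq G).mono fun ω hω => by simp only; rw [hω]
  rw [integral_congr_ae hae]
  induction G.n with
  | zero => simp
  | succ n ih =>
    have h := L.integral_mul_exp_increment (G.mono (Nat.le_succ n)) (G.u n)
      ((by fun_prop : Continuous fun x : ℝ =>
        Complex.exp (x * Complex.I)).comp_aestronglyMeasurable (L.adapted_sum G n))
    rw [Finset.prod_range_succ, ← ih]
    refine Eq.trans (integral_congr_ae (ae_of_all _ fun ω => ?_)) h
    simp only
    rw [← Complex.exp_add, Finset.sum_range_succ]
    congr 1
    push_cast
    ring

theorem integrable_indicator_Ioc_toNNReal {W : Type*} [NormedAddCommGroup W] [NormedSpace ℝ W]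
    [CompleteSpace W] (a b : ℝ≥0) (hab : a ≤ b) (c : W) :
    Integrable (fun r : ℝ => (Ioc a b).indicator (fun _ => c) r.toNNReal) ∧
      ∫ r : ℝ, (Ioc a b).indicator (fun _ => c) r.toNNReal = ((b : ℝ) - a) • c := by
  have h : (fun r : ℝ => (Ioc a b).indicator (fun _ => c) r.toNNReal) =
      (Ioc (a : ℝ) b).indicator fun _ => c := by
    ext r
    simp [indicator, Real.lt_toNNReal_iff_coe_lt, Real.toNNReal_le_iff_le_coe]
  rw [h]
  refine ⟨(integrable_indicator_iff measurableSet_Ioc).2 (integrableOn_const (by simp)), ?_⟩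
  rw [integral_indicator measurableSet_Ioc, setIntegral_const, Real.volume_real_Ioc_of_le
    (by exact_mod_cast hab)]

theorem integrable_symbol_eval [IsProbabilityMeasure P]
    (L : CylindricalLevyProcess U ℱ P) (G : StepFunction U) :
    Integrable fun r : ℝ => L.symbol (G.eval r.toNNReal) := by
  simp only [StepFunction.map_eval L.symbol L.symbol_zero]
  exact integrable_finsetSum _ fun k _ =>
    (integrable_indicator_Ioc_toNNReal _ _ (G.mono (Nat.le_succ k)) _).1

theorem integral_exp_stepIntegral [IsProbabilityMeasure P]
    (L : CylindricalLevyProcess U ℱ P) (G : StepFunction U) :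
    ∫ ω, Complex.exp (L.stepIntegral G ω * Complex.I) ∂P =
      Complex.exp (∫ r : ℝ, L.symbol (G.eval r.toNNReal)) := by
  simp only [StepFunction.map_eval L.symbol L.symbol_zero]
  rw [integral_finsetSum _ fun k _ =>
      (integrable_indicator_Ioc_toNNReal _ _ (G.mono (Nat.le_succ k)) _).1,
    Complex.exp_sum, integral_exp_stepIntegral_eq_prod]
  refine Finset.prod_congr rfl fun k _ => ?_
  rw [(integrable_indicator_Ioc_toNNReal _ _ (G.mono (Nat.le_succ k)) _).2, chf_eq_exp]
  rw [NNReal.sub_def]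
  have : (0 : ℝ) ≤ G.t (k + 1) - G.t k := sub_nonneg.2 (by exact_mod_cast G.mono (Nat.le_succ k))
  rw [Real.coe_toNNReal _ this, Complex.real_smul]

end CylindricalLevyProcess

/-! ### From characteristic functions to convergence in probability -/

/-- Pointwise convergence of the characteristic functions to `1` implies convergence to `0` in
probability. -/
theorem tendstoInMeasure_zero_of_tendsto_integral_exp {Ω : Type*} {mΩ : MeasurableSpace Ω}
    {P : Measure Ω} [IsProbabilityMeasure P] {X : ℕ → Ω → ℝ} (hX : ∀ m, AEMeasurable (X m) P)
    (h : ∀ x : ℝ, Tendsto (fun m => ∫ ω, Complex.exp ((x * X m ω : ℝ) * Complex.I) ∂P) atTop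
      (𝓝 1)) :
    TendstoInMeasure P X atTop 0 := by
  let μ : ℕ → ProbabilityMeasure ℝ := fun m =>
    ⟨P.map (X m), Measure.isProbabilityMeasure_map (hX m)⟩
  let δ : ProbabilityMeasure ℝ := ⟨Measure.dirac 0, inferInstance⟩
  have hconv : Tendsto μ atTop (𝓝 δ) := by
    refine ProbabilityMeasure.tendsto_of_tendsto_charFun fun x => ?_
    have h1 : charFun (δ : Measure ℝ) x = 1 := by simp [δ, charFun_dirac]
    rw [h1]
    refine (h x).congr fun m => ?_
    change _ = charFun (P.map (X m)) x
    rw [charFun_apply_real, integral_map (hX m) (by fun_prop)]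
    simp
  rw [tendstoInMeasure_iff_norm]
  intro ε hε
  -- The closed set avoids `0`, so it and its frontier are null for the Dirac mass and the
  -- portmanteau theorem applies.
  have hcl : IsClosed {x : ℝ | ε ≤ ‖x‖} := isClosed_le continuous_const continuous_norm
  have hlim := ProbabilityMeasure.tendsto_measure_of_null_frontier_of_tendsto' hconv
    (E := {x : ℝ | ε ≤ ‖x‖}) (by
      have hsub : frontier {x : ℝ | ε ≤ ‖x‖} ⊆ {x | ε ≤ ‖x‖} := hcl.frontier_subset
      refine measure_mono_null hsub ?_
      simp [δ, hε])
  have h0 : (δ : Measure ℝ) {x : ℝ | ε ≤ ‖x‖} = 0 := by simp [δ, hε]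
  rw [h0] at hlim
  refine hlim.congr fun m => ?_
  change P.map (X m) _ = _
  rw [Measure.map_apply_of_aemeasurable (hX m) hcl.measurableSet]
  simp

theorem tendstoInMeasure_add {Ω ι : Type*} {mΩ : MeasurableSpace Ω} {P : Measure Ω} {l : Filter ι}
    {X Y : ι → Ω → ℝ} {x y : Ω → ℝ} (hX : TendstoInMeasure P X l x)
    (hY : TendstoInMeasure P Y l y) :
    TendstoInMeasure P (fun i ω => X i ω + Y i ω) l (fun ω => x ω + y ω) := by
  rw [tendstoInMeasure_iff_norm] at *
  intro ε hε
  have h := (hX (ε / 2) (half_pos hε)).add (hY (ε / 2) (half_pos hε))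
  rw [add_zero] at h
  refine tendsto_of_tendsto_of_tendsto_of_le_of_le tendsto_const_nhds h (fun _ => zero_le)
    fun i => (measure_mono fun ω hω => ?_).trans (measure_union_le _ _)
  by_contra hcon
  simp only [mem_union, mem_ofPred_eq, not_or, not_le] at hcon hω
  have := norm_add_le (X i ω - x ω) (Y i ω - y ω)
  rw [← add_sub_add_comm] at this
  linarith [hcon.1, hcon.2]

theorem tendstoInMeasure_neg {Ω ι : Type*} {mΩ : MeasurableSpace Ω} {P : Measure Ω} {l : Filter ι}
    {X : ι → Ω → ℝ} {x : Ω → ℝ} (hX : TendstoInMeasure P X l x) :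
    TendstoInMeasure P (fun i ω => -X i ω) l (fun ω => -x ω) := by
  intro ε hε
  simpa [edist_neg_neg] using hX ε hε

/-! ### Integrals as limits of step integrals -/

namespace CylindricalLevyProcess

variable {U : Type*} [NormedAddCommGroup U] [InnerProductSpace ℝ U]
  {Ω : Type*} {mΩ : MeasurableSpace Ω} {ℱ : Filtration ℝ≥0 mΩ} {P : Measure Ω}

theorem tendsto_integral_symbol [IsProbabilityMeasure P] (L : CylindricalLevyProcess U ℱ P)
    {T : ℝ≥0} {G : ℕ → StepFunction U} {C : ℝ} {g : ℝ≥0 → U} (hT : ∀ m, (G m).t (G m).n ≤ T)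
    (hC : ∀ m s, ‖(G m).eval s‖ ≤ C)
    (hg : ∀ᵐ r ∂(volume.restrict (Icc (0 : ℝ) T)),
      Tendsto (fun m => (G m).eval r.toNNReal) atTop (𝓝 (g r.toNNReal))) :
    IntegrableOn (fun r : ℝ => L.symbol (g r.toNNReal)) (Icc 0 T) ∧
    Tendsto (fun m => ∫ r : ℝ, L.symbol ((G m).eval r.toNNReal)) atTop
      (𝓝 (∫ r in Icc (0 : ℝ) T, L.symbol (g r.toNNReal))) := by
  obtain ⟨M, hM⟩ := L.exists_norm_symbol_le C
  have hmeas : ∀ m, AEStronglyMeasurable (fun r : ℝ => L.symbol ((G m).eval r.toNNReal))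
      (volume.restrict (Icc (0 : ℝ) T)) := fun m =>
    (L.integrable_symbol_eval (G m)).aestronglyMeasurable.restrict
  have hlim : ∀ᵐ r ∂(volume.restrict (Icc (0 : ℝ) T)),
      Tendsto (fun m => L.symbol ((G m).eval r.toNNReal)) atTop
        (𝓝 (L.symbol (g r.toNNReal))) := by
    filter_upwards [hg] with r hr using (L.continuous_symbol.tendsto _).comp hr
  refine ⟨?_, ?_⟩
  · refine Integrable.of_bound (aestronglyMeasurable_of_tendsto_ae atTop hmeas hlim) M ?_
    filter_upwards [hlim] with r hr
    exact le_of_tendsto hr.norm (Eventually.of_forall fun m => hM _ (hC m _))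
  -- Step functions vanish outside `(0, T]` and the symbol vanishes at `0`.
  · have hset : ∀ m, ∫ r : ℝ, L.symbol ((G m).eval r.toNNReal) =
        ∫ r in Icc (0 : ℝ) T, L.symbol ((G m).eval r.toNNReal) := fun m => by
      refine (setIntegral_eq_integral_of_forall_compl_eq_zero fun r hr => ?_).symm
      rw [mem_Icc, not_and_or, not_le, not_le] at hr
      rcases hr with hr | hr
      · rw [Real.toNNReal_of_nonpos hr.le, StepFunction.eval_zero, symbol_zero]
      · rw [StepFunction.eval_eq_zero_of_lt _
          ((hT m).trans_lt (Real.lt_toNNReal_iff_coe_lt.2 hr)), symbol_zero]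
    simp only [hset]
    exact tendsto_integral_of_dominated_convergence (fun _ => M) hmeas
      (integrable_const M) (fun m => ae_of_all _ fun r => hM _ (hC m _)) hlim

theorem IsIntegral.integrableOn_symbol [IsProbabilityMeasure P] {L : CylindricalLevyProcess U ℱ P}
    {T : ℝ≥0} {g : ℝ≥0 → U} {X : Ω → ℝ} (h : L.IsIntegral T g X) :
    IntegrableOn (fun r : ℝ => L.symbol (g r.toNNReal)) (Icc 0 T) := by
  obtain ⟨G, C, hT, hC, hg, -⟩ := h
  exact (L.tendsto_integral_symbol hT hC hg).1

theorem IsIntegral.integral_exp [IsProbabilityMeasure P] {L : CylindricalLevyProcess U ℱ P}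
    {T : ℝ≥0} {g : ℝ≥0 → U} {X : Ω → ℝ} (h : L.IsIntegral T g X) :
    ∫ ω, Complex.exp (X ω * Complex.I) ∂P =
      Complex.exp (∫ r in Icc (0 : ℝ) T, L.symbol (g r.toNNReal)) := by
  obtain ⟨G, C, hT, hC, hg, hX⟩ := h
  refine tendsto_nhds_unique
    (hX.tendsto_integral_exp fun m => AEEqFun.aestronglyMeasurable _) ?_
  simp only [integral_exp_stepIntegral]
  exact (Complex.continuous_exp.tendsto _).comp (L.tendsto_integral_symbol hT hC hg).2

/-- The characteristic function at `x` belongs to the step functions scaled by `x`, and its exponent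
tends to the integral of `Ψ(0) = 0`. -/
theorem tendstoInMeasure_stepIntegral_zero [IsProbabilityMeasure P]
    (L : CylindricalLevyProcess U ℱ P) {T : ℝ≥0} {G : ℕ → StepFunction U} {C : ℝ}
    (hT : ∀ m, (G m).t (G m).n ≤ T) (hC : ∀ m s, ‖(G m).eval s‖ ≤ C)
    (hg : ∀ᵐ r ∂(volume.restrict (Icc (0 : ℝ) T)),
      Tendsto (fun m => (G m).eval r.toNNReal) atTop (𝓝 0)) :
    TendstoInMeasure P (fun (m : ℕ) (ω : Ω) => L.stepIntegral (G m) ω) atTop 0 := by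
  refine tendstoInMeasure_zero_of_tendsto_integral_exp
    (fun m => AEEqFun.aemeasurable _) fun x => ?_
  have h := (L.tendsto_integral_symbol (G := fun m => (G m).smul x) (C := |x| * C) (g := 0) hT
    (fun m s => by
      rw [StepFunction.eval_smul, norm_smul]
      exact mul_le_mul_of_nonneg_left (hC m s) (abs_nonneg x)) (by
      filter_upwards [hg] with r hr
      simp only [StepFunction.eval_smul]
      simpa using hr.const_smul x)).2
  have h' := (Complex.continuous_exp.tendsto _).comp h
  simp only [Pi.zero_apply, symbol_zero, integral_zero, Complex.exp_zero] at h'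
  refine h'.congr fun m => ?_
  rw [Function.comp_apply, ← integral_exp_stepIntegral, stepIntegral_smul]
  refine integral_congr_ae ?_
  filter_upwards [AEEqFun.coeFn_smul x (L.stepIntegral (G m))] with ω hω
  rw [hω, Pi.smul_apply, smul_eq_mul]

/-- Truncate the approximants at `s`. What is cut off tends to `0` almost everywhere, hence its
integrals tend to `0` in probability. -/
theorem IsIntegral.of_le [IsProbabilityMeasure P] {L : CylindricalLevyProcess U ℱ P}
    {s T : ℝ≥0} (hs : s ≤ T) {g : ℝ≥0 → U} {X : Ω → ℝ}
    (h : L.IsIntegral T ((Icc 0 s).indicator g) X) :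
    L.IsIntegral s ((Icc 0 s).indicator g) X := by
  obtain ⟨G, C, hT, hC, hg, hX⟩ := h
  have hC0 : 0 ≤ C := (norm_nonneg _).trans (hC 0 0)
  refine ⟨fun m => (G m).truncate s, C, fun m => min_le_right _ _, fun m r => ?_, ?_, ?_⟩
  · rw [StepFunction.eval_truncate]
    exact (norm_indicator_le_norm_self _ _).trans (hC m r)
  · have hsub : Icc (0 : ℝ) s ⊆ Icc 0 T := Icc_subset_Icc_right (by exact_mod_cast hs)
    filter_upwards [ae_restrict_of_ae_restrict_of_subset hsub hg,
      ae_restrict_mem measurableSet_Icc] with r hr hrs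
    have : r.toNNReal ∈ Iic s := Real.toNNReal_le_iff_le_coe.2 hrs.2
    simpa only [StepFunction.eval_truncate, indicator_of_mem this] using hr
  · have h0 := L.tendstoInMeasure_stepIntegral_zero (T := T) (C := C)
      (G := fun m => (G m).startAt s) (fun m => max_le (hT m) hs) (fun m r => by
        rw [StepFunction.eval_startAt]
        exact (norm_indicator_le_norm_self _ _).trans (hC m r)) (by
        filter_upwards [hg] with r hr
        by_cases hrs : r.toNNReal ≤ s
        · simp [StepFunction.eval_startAt, not_lt.2 hrs]
        · have h1 : r.toNNReal ∉ Icc 0 s := fun h => hrs h.2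
          have h2 : r.toNNReal ∈ Ioi s := not_le.1 hrs
          rw [indicator_of_notMem h1] at hr
          simpa only [StepFunction.eval_startAt, indicator_of_mem h2] using hr)
    refine (tendstoInMeasure_add hX (tendstoInMeasure_neg h0)).congr (fun m => ?_) ?_
    · filter_upwards [AEEqFun.coeFn_add (L.stepIntegral ((G m).truncate s))
        (L.stepIntegral ((G m).startAt s))] with ω hω
      rw [stepIntegral_truncate_add_startAt] at hω
      rw [hω, Pi.add_apply, add_neg_cancel_right]
    · exact ae_of_all _ fun ω => by simp

end CylindricalLevyProcess

/-! ### Translation in time and existence of the integral on every `[0, t]` -/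

theorem C0Semigroup.adjoint_add {V : Type*} [NormedAddCommGroup V] [InnerProductSpace ℝ V]
    [CompleteSpace V] (T : C0Semigroup V) (s r : ℝ≥0) (v : V) :
    (T.toFun (s + r)).adjoint v = (T.toFun r).adjoint ((T.toFun s).adjoint v) := by
  rw [T.map_add, ContinuousLinearMap.adjoint_comp]
  rfl

theorem C0Semigroup.adjoint_comp_add {U V : Type*} [NormedAddCommGroup U] [InnerProductSpace ℝ U]
    [CompleteSpace U] [NormedAddCommGroup V] [InnerProductSpace ℝ V] [CompleteSpace V]
    (T : C0Semigroup V) (B : U →L[ℝ] V) (s r : ℝ≥0) (v : V) :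
    ((T.toFun (s + r)).comp B).adjoint v =
      ((T.toFun r).comp B).adjoint ((T.toFun s).adjoint v) := by
  rw [T.map_add, ContinuousLinearMap.comp_assoc, ContinuousLinearMap.adjoint_comp]
  rfl

/-- The Cramér–Wold device. -/
theorem identDistrib_of_forall_integral_exp {Ω ι : Type*} [Fintype ι] {mΩ : MeasurableSpace Ω}
    {P : Measure Ω} [IsProbabilityMeasure P] {X Y : Ω → ι → ℝ} (hX : AEMeasurable X P)
    (hY : AEMeasurable Y P)
    (h : ∀ c : ι → ℝ, ∫ ω, Complex.exp ((∑ i, c i * X ω i : ℝ) * Complex.I) ∂P =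
      ∫ ω, Complex.exp ((∑ i, c i * Y ω i : ℝ) * Complex.I) ∂P) :
    IdentDistrib X Y P P := by
  classical
  refine ⟨hX, hY, ?_⟩
  have := Measure.isProbabilityMeasure_map hX
  have := Measure.isProbabilityMeasure_map hY
  refine Measure.ext_of_charFunDual (funext fun l => ?_)
  rw [charFunDual_apply, charFunDual_apply, integral_map hX (by fun_prop),
    integral_map hY (by fun_prop)]
  obtain ⟨c, hl⟩ : ∃ c : ι → ℝ, ∀ x : ι → ℝ, l x = ∑ i, c i * x i := by
    refine ⟨fun i => l fun j => if i = j then 1 else 0, fun x => ?_⟩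
    have := (l : (ι → ℝ) →ₗ[ℝ] ℝ).pi_apply_eq_sum_univ x
    simp only [ContinuousLinearMap.coe_coe, smul_eq_mul] at this
    rw [this]
    exact Finset.sum_congr rfl fun i _ => mul_comm _ _
  simp only [hl]
  exact h c

theorem Real.toNNReal_sub_coe (r : ℝ) (s : ℝ≥0) : (r - s).toNNReal = r.toNNReal - s := by
  ext
  rw [NNReal.coe_sub_def, Real.coe_toNNReal', Real.coe_toNNReal']
  rcases le_total 0 r with h | h
  · rw [max_eq_left h]
  · rw [max_eq_right h, max_eq_right (by linarith [s.2]), max_eq_right (by linarith [s.2])]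

namespace CylindricalLevyProcess

variable {U : Type*} [NormedAddCommGroup U] [InnerProductSpace ℝ U]
  {Ω : Type*} {mΩ : MeasurableSpace Ω} {ℱ : Filtration ℝ≥0 mΩ} {P : Measure Ω}

theorem integral_exp_sum_stepIntegral [IsProbabilityMeasure P] (L : CylindricalLevyProcess U ℱ P)
    {κ : Type*} [Fintype κ] (c : κ → ℝ) (G : κ → StepFunction U) :
    ∫ ω, Complex.exp ((∑ i, c i * L.stepIntegral (G i) ω : ℝ) * Complex.I) ∂P =
      Complex.exp (∫ r : ℝ, L.symbol (∑ i, c i • (G i).eval r.toNNReal)) := by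
  obtain ⟨H, h1, h2⟩ := L.exists_stepFunction_sum Finset.univ c G
  simp only [← h1]
  rw [← integral_exp_stepIntegral, h2]
  refine integral_congr_ae ?_
  have hsum : ∀ I : Finset κ, ((∑ i ∈ I, c i • L.stepIntegral (G i) : Ω →ₘ[P] ℝ) : Ω → ℝ) =ᵐ[P]
      fun ω => ∑ i ∈ I, c i * L.stepIntegral (G i) ω := by
    classical
    intro I
    induction I using Finset.induction_on with
    | empty =>
      filter_upwards [AEEqFun.coeFn_zero (μ := P) (β := ℝ)] with ω hω
      simp [hω]
    | insert i I hi ih =>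
      rw [Finset.sum_insert hi]
      filter_upwards [ih, AEEqFun.coeFn_add (c i • L.stepIntegral (G i))
        (∑ i ∈ I, c i • L.stepIntegral (G i)), AEEqFun.coeFn_smul (c i) (L.stepIntegral (G i))]
        with ω e1 e2 e3
      rw [e2, Pi.add_apply, e1, e3, Finset.sum_insert hi, Pi.smul_apply, smul_eq_mul]
  filter_upwards [hsum Finset.univ] with ω hω
  rw [hω]

/-- The law of a family of step integrals is invariant under translation in time. -/
theorem identDistrib_stepIntegral_shift [IsProbabilityMeasure P]
    (L : CylindricalLevyProcess U ℱ P) (s : ℝ≥0) {κ : Type*} (G : κ → StepFunction U) :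
    IdentDistrib (fun ω k => L.stepIntegral (G k) ω)
      (fun ω k => L.stepIntegral ((G k).shift s) ω) P P := by
  have hm : ∀ f : Ω →ₘ[P] ℝ, Measurable (f : Ω → ℝ) := fun f => f.stronglyMeasurable.measurable
  refine (identDistrib_iff_forall_finset_identDistrib
    (X := fun k ω => L.stepIntegral (G k) ω) (Y := fun k ω => L.stepIntegral ((G k).shift s) ω)
    (measurable_pi_lambda _ fun k => hm _).aemeasurable
    (measurable_pi_lambda _ fun k => hm _).aemeasurable).2 fun I => ?_
  refine identDistrib_of_forall_integral_exp
    (measurable_pi_lambda _ fun k => hm _).aemeasurable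
    (measurable_pi_lambda _ fun k => hm _).aemeasurable fun c => ?_
  simp only [Finset.restrict]
  rw [L.integral_exp_sum_stepIntegral c fun i => G i,
    L.integral_exp_sum_stepIntegral c fun i => (G i).shift s]
  congr 1
  -- Only translation invariance of Lebesgue measure on `ℝ` is at work: positive parts turn `r - s`
  -- into truncated subtraction.
  rw [← integral_sub_right_eq_self _ (s : ℝ)]
  simp only [StepFunction.eval_shift]
  simp only [Real.toNNReal_sub_coe]

variable {V : Type*} [NormedAddCommGroup V] [InnerProductSpace ℝ V] [CompleteSpace V]
  [TopologicalSpace.SeparableSpace V] [MeasurableSpace V] [BorelSpace V]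

/-- A vector is determined by its inner products with a dense sequence. This injective continuous
map on a Polish space is a measurable embedding, so it has a measurable left inverse. -/
theorem exists_measurable_of_tendsto_inner :
    ∃ F : (ℕ → ℕ → ℝ) → V, Measurable F ∧ ∀ (x : V) (y : ℕ → ℕ → ℝ),
      (∀ k, Tendsto (y k) atTop (𝓝 ⟪x, TopologicalSpace.denseSeq V k⟫_ℝ)) → F y = x := by
  have hcont : Continuous fun (x : V) (k : ℕ) => ⟪x, TopologicalSpace.denseSeq V k⟫_ℝ := by
    fun_prop
  have hinj : Function.Injective fun (x : V) (k : ℕ) => ⟪x, TopologicalSpace.denseSeq V k⟫_ℝ := by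
    intro x y hxy
    have h : (fun v => ⟪x, v⟫_ℝ) = fun v => ⟪y, v⟫_ℝ :=
      Continuous.ext_on (TopologicalSpace.denseRange_denseSeq V) (by fun_prop) (by fun_prop)
        (by rintro _ ⟨k, rfl⟩; exact congrFun hxy k)
    exact ext_inner_right ℝ fun v => congrFun h v
  have : SecondCountableTopology V := UniformSpace.secondCountable_of_separable V
  obtain ⟨F, hF, hFid⟩ := (hcont.measurableEmbedding hinj).exists_measurable_extend
    measurable_id fun _ => ⟨(0 : V)⟩
  refine ⟨fun y => F fun k => limUnder atTop (y k), hF.comp ?_, fun x y hy => ?_⟩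
  · refine measurable_pi_lambda _ fun k => StronglyMeasurable.measurable ?_
    exact StronglyMeasurable.limUnder fun m => Measurable.stronglyMeasurable (by fun_prop)
  · simp only [fun k => (hy k).limUnder_eq]
    exact congrFun hFid x

/-- If step integrals converge in probability to the projections of a `V`-valued random variable,
then so do the translated step integrals. -/
theorem exists_tendstoInMeasure_shift [IsProbabilityMeasure P]
    (L : CylindricalLevyProcess U ℱ P) (s : ℝ≥0) (X : Ω →ₘ[P] V) (G : V → ℕ → StepFunction U)
    (h : ∀ v, TendstoInMeasure P (fun m ω => L.stepIntegral (G v m) ω) atTop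
      (fun ω => ⟪X ω, v⟫_ℝ)) :
    ∃ J : Ω →ₘ[P] V, ∀ v, TendstoInMeasure P
      (fun m ω => L.stepIntegral ((G v m).shift s) ω) atTop (fun ω => ⟪J ω, v⟫_ℝ) := by
  have : SecondCountableTopology V := UniformSpace.secondCountable_of_separable V
  have hm : ∀ f : Ω →ₘ[P] ℝ, Measurable (f : Ω → ℝ) := fun f => f.stronglyMeasurable.measurable
  obtain ⟨F, hF, hFX⟩ := exists_measurable_of_tendsto_inner (V := V)
  choose ns _ hns using fun v => (h v).exists_seq_tendsto_ae
  let d := TopologicalSpace.denseSeq V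
  let D : ℕ → ℕ → StepFunction U := fun k m => G (d k) (ns (d k) m)
  -- `X` is almost surely a measurable function of countably many step integrals; the same function
  -- of the translated ones defines `J`.
  have hX : ∀ᵐ ω ∂P, F (fun k m => L.stepIntegral (D k m) ω) = X ω := by
    filter_upwards [ae_all_iff.2 fun k => hns (d k)] with ω hω
    exact hFX _ _ hω
  have hJm : Measurable fun ω => F fun k m => L.stepIntegral ((D k m).shift s) ω :=
    hF.comp (measurable_pi_lambda _ fun k => measurable_pi_lambda _ fun m => hm _)
  let J : Ω →ₘ[P] V := AEEqFun.mk _ hJm.aestronglyMeasurable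
  have hJ : (J : Ω → V) =ᵐ[P] fun ω => F fun k m => L.stepIntegral ((D k m).shift s) ω :=
    AEEqFun.coeFn_mk _ _
  refine ⟨J, fun v => ?_⟩
  have hv := h v
  rw [tendstoInMeasure_iff_norm] at hv ⊢
  intro ε hε
  refine (hv ε hε).congr fun m => ?_
  -- `none` indexes the integral being tested, `some` those that reconstruct the limit. The event
  -- depends on this joint family only, whose law is shift invariant.
  let E : Option (ℕ × ℕ) → StepFunction U := fun o => o.elim (G v m) fun p => D p.1 p.2
  have hid := L.identDistrib_stepIntegral_shift s E
  have hset : MeasurableSet {y : Option (ℕ × ℕ) → ℝ |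
      ε ≤ ‖y none - ⟪F fun k j => y (some (k, j)), v⟫_ℝ‖} := by
    refine measurableSet_le measurable_const (Measurable.norm (Measurable.sub (by fun_prop) ?_))
    refine Measurable.inner (hF.comp ?_) measurable_const
    exact measurable_pi_lambda _ fun k => measurable_pi_lambda _ fun j => measurable_pi_apply _
  have hmeas := hid.measure_mem_eq hset
  have e1 : P {ω | ε ≤ ‖L.stepIntegral (G v m) ω - ⟪X ω, v⟫_ℝ‖} =
      P ((fun ω k => L.stepIntegral (E k) ω) ⁻¹' {y : Option (ℕ × ℕ) → ℝ |
        ε ≤ ‖y none - ⟪F fun k j => y (some (k, j)), v⟫_ℝ‖}) := by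
    refine measure_congr (eventuallyEq_set.2 ?_)
    filter_upwards [hX] with ω hω
    simp [E, hω]
  have e2 : P {ω | ε ≤ ‖L.stepIntegral ((G v m).shift s) ω - ⟪J ω, v⟫_ℝ‖} =
      P ((fun ω k => L.stepIntegral ((E k).shift s) ω) ⁻¹' {y : Option (ℕ × ℕ) → ℝ |
        ε ≤ ‖y none - ⟪F fun k j => y (some (k, j)), v⟫_ℝ‖}) := by
    refine measure_congr (eventuallyEq_set.2 ?_)
    filter_upwards [hJ] with ω hω
    simp [E, hω]
  rw [e1, hmeas, ← e2]

variable [CompleteSpace U]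

/-- On `(s, s + t]` the integrand is `T(s) T(r - s) B`, so that part of the integral is `T(s)`
applied to a time-shifted copy of `Y`. -/
theorem exists_isStochasticIntegral_add [IsProbabilityMeasure P]
    (L : CylindricalLevyProcess U ℱ P) (T : C0Semigroup V) (B : U →L[ℝ] V) {s t : ℝ≥0}
    {X Y : Ω →ₘ[P] V}
    (hX : L.IsStochasticIntegral s (Icc 0 s) (fun r => (T.toFun r).comp B) X)
    (hY : L.IsStochasticIntegral t (Icc 0 t) (fun r => (T.toFun r).comp B) Y) :
    ∃ Z : Ω →ₘ[P] V,
      L.IsStochasticIntegral (s + t) (Icc 0 (s + t)) (fun r => (T.toFun r).comp B) Z := by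
  choose G C hGT hGC hG hGX using hX
  choose G' C' hGT' hGC' hG' hGY using hY
  obtain ⟨J, hJ⟩ := L.exists_tendstoInMeasure_shift s Y G' hGY
  refine ⟨X + J.comp (T.toFun s) (T.toFun s).continuous, fun v => ?_⟩
  let w := (T.toFun s).adjoint v
  have hb : ∀ m, ((G' w m).shift s).t ((G' w m).shift s).n ≤ s + t := fun m =>
    add_le_add_right (hGT' w m) s
  choose H hHT hHe hHi using fun m =>
    L.exists_stepFunction_add (G v m) ((G' w m).shift s) ((hGT v m).trans le_self_add) (hb m)
  refine ⟨H, C v + C' w, hHT, fun m r => ?_, ?_, ?_⟩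
  · rw [hHe]
    exact (norm_add_le _ _).trans (add_le_add (hGC v m r)
      (by rw [StepFunction.eval_shift]; exact hGC' w m _))
  · have h1 := (ae_restrict_iff' measurableSet_Icc).1 (hG v)
    have h2 := (measurePreserving_sub_right volume (s : ℝ)).quasiMeasurePreserving.ae
      ((ae_restrict_iff' measurableSet_Icc).1 (hG' w))
    rw [ae_restrict_iff' measurableSet_Icc]
    filter_upwards [h1, h2] with r h1 h2 hr
    simp only [hHe, StepFunction.eval_shift]
    have hmem : r.toNNReal ∈ Icc 0 (s + t) :=
      ⟨zero_le, Real.toNNReal_le_iff_le_coe.2 hr.2⟩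
    rw [indicator_of_mem hmem]
    -- Before `s` the shifted approximants are evaluated at `0`, where they vanish; after `s` the
    -- unshifted ones vanish.
    by_cases hrs : r ≤ s
    · have hrs' : r.toNNReal ≤ s := Real.toNNReal_le_iff_le_coe.2 hrs
      rw [indicator_of_mem (show r.toNNReal ∈ Icc 0 s from ⟨zero_le, hrs'⟩)] at h1
      simpa [tsub_eq_zero_of_le hrs'] using h1 ⟨hr.1, hrs⟩
    · have hrs' : s < r.toNNReal := Real.lt_toNNReal_iff_coe_lt.2 (not_le.1 hrs)
      have hr2 : r - s ≤ t := by
        have := hr.2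
        push_cast at this
        linarith
      have h3 := h2 ⟨sub_nonneg.2 (not_le.1 hrs).le, hr2⟩
      rw [Real.toNNReal_sub_coe, indicator_of_mem (show r.toNNReal - s ∈ Icc 0 t from
        ⟨zero_le, by rw [← Real.toNNReal_sub_coe]; exact Real.toNNReal_le_iff_le_coe.2 hr2⟩),
        ← C0Semigroup.adjoint_comp_add, add_tsub_cancel_of_le hrs'.le] at h3
      refine h3.congr fun m => ?_
      rw [StepFunction.eval_eq_zero_of_lt _ ((hGT v m).trans_lt hrs'), zero_add]
  · refine (tendstoInMeasure_add (hGX v) (hJ w)).congr (fun m => ?_) ?_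
    · filter_upwards [AEEqFun.coeFn_add (L.stepIntegral (G v m))
        (L.stepIntegral ((G' w m).shift s))] with ω hω
      rw [hHi, hω, Pi.add_apply]
    · filter_upwards [AEEqFun.coeFn_add X (J.comp (T.toFun s) (T.toFun s).continuous),
        AEEqFun.coeFn_comp (T.toFun s) (T.toFun s).continuous J] with ω h1 h2
      rw [h1, Pi.add_apply, h2, inner_add_left, Function.comp_apply,
        ContinuousLinearMap.adjoint_inner_right]

theorem exists_isStochasticIntegral [IsProbabilityMeasure P]
    (L : CylindricalLevyProcess U ℱ P) (T : C0Semigroup V) (B : U →L[ℝ] V)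
    (hTB : ∃ T₀ : ℝ≥0, 0 < T₀ ∧ L.StochasticallyIntegrable T₀ fun s => (T.toFun s).comp B)
    (t : ℝ≥0) :
    ∃ Z : Ω →ₘ[P] V, L.IsStochasticIntegral t (Icc 0 t) (fun r => (T.toFun r).comp B) Z := by
  obtain ⟨T₀, hT₀, hint⟩ := hTB
  have hsmall : ∀ t ≤ T₀, ∃ Z : Ω →ₘ[P] V,
      L.IsStochasticIntegral t (Icc 0 t) (fun r => (T.toFun r).comp B) Z := fun t ht => by
    obtain ⟨Z, hZ⟩ := hint (Icc 0 t) measurableSet_Icc (Icc_subset_Icc_right ht)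
    exact ⟨Z, fun v => (hZ v).of_le ht⟩
  have hmul : ∀ (n : ℕ) (t : ℝ≥0), t ≤ T₀ → ∃ Z : Ω →ₘ[P] V,
      L.IsStochasticIntegral (n * t) (Icc 0 (n * t)) (fun r => (T.toFun r).comp B) Z := by
    intro n t ht
    induction n with
    | zero => exact hsmall _ (by simp)
    | succ n ih =>
      obtain ⟨X, hX⟩ := ih
      obtain ⟨Y, hY⟩ := hsmall t ht
      rw [Nat.cast_succ, add_mul, one_mul]
      exact L.exists_isStochasticIntegral_add T B hX hY
  -- Cut `[0, t]` into `n` pieces of length `t / n ≤ T₀`.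
  obtain ⟨n, hn⟩ := exists_nat_gt (t / T₀)
  have hn0 : (0 : ℝ≥0) < n := zero_le.trans_lt hn
  have := hmul n (t / n) (by
    rw [div_le_iff₀ hn0, mul_comm]
    exact ((div_lt_iff₀ hT₀).1 hn).le)
  rwa [mul_div_cancel₀ _ hn0.ne'] at this

end CylindricalLevyProcess

/-! ### Characteristic function of `ν_t` and stationarity -/

theorem ProbabilityMeasure.tendsto_charFun {V ι : Type*} [NormedAddCommGroup V]
    [InnerProductSpace ℝ V] [MeasurableSpace V] [BorelSpace V] {l : Filter ι}
    {μ : ι → ProbabilityMeasure V} {ρ : ProbabilityMeasure V} (h : Tendsto μ l (𝓝 ρ)) (v : V) :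
    Tendsto (fun i => charFun (μ i : Measure V) v) l (𝓝 (charFun (ρ : Measure V) v)) := by
  rw [ProbabilityMeasure.tendsto_iff_forall_integral_rclike_tendsto ℂ] at h
  simp_rw [charFun_eq_integral_innerProbChar]
  exact h (BoundedContinuousFunction.innerProbChar v)

theorem charFun_map_continuousLinearMap {V : Type*} [NormedAddCommGroup V]
    [InnerProductSpace ℝ V] [CompleteSpace V] [MeasurableSpace V] [BorelSpace V]
    [TopologicalSpace.SeparableSpace V] (μ : Measure V)
    (A : V →L[ℝ] V) (v : V) : charFun (μ.map A) v = charFun μ (A.adjoint v) := by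
  have : SecondCountableTopology V := UniformSpace.secondCountable_of_separable V
  rw [charFun_apply, charFun_apply, integral_map A.continuous.aemeasurable
    (by fun_prop)]
  simp only [ContinuousLinearMap.adjoint_inner_right]

namespace CylindricalLevyProcess

variable {U : Type*} [NormedAddCommGroup U] [InnerProductSpace ℝ U] [CompleteSpace U]
  {V : Type*} [NormedAddCommGroup V] [InnerProductSpace ℝ V] [CompleteSpace V]
  [TopologicalSpace.SeparableSpace V] [MeasurableSpace V] [BorelSpace V]
  {Ω : Type*} {mΩ : MeasurableSpace Ω} {ℱ : Filtration ℝ≥0 mΩ} {P : Measure Ω}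
  [IsProbabilityMeasure P]

theorem charFun_convolutionLaw (L : CylindricalLevyProcess U ℱ P) (T : C0Semigroup V)
    (B : U →L[ℝ] V)
    (hTB : ∃ T₀ : ℝ≥0, 0 < T₀ ∧ L.StochasticallyIntegrable T₀ fun s => (T.toFun s).comp B)
    (t : ℝ≥0) (v : V) :
    IntervalIntegrable (fun r : ℝ => L.symbol (((T.toFun r.toNNReal).comp B).adjoint v))
      volume 0 t ∧
    charFun (L.convolutionLaw T B t : Measure V) v =
      Complex.exp (∫ r in (0 : ℝ)..t,
        L.symbol (((T.toFun r.toNNReal).comp B).adjoint v)) := by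
  have : SecondCountableTopology V := UniformSpace.secondCountable_of_separable V
  have hex := L.exists_isStochasticIntegral T B hTB t
  have hint : L.IsStochasticIntegral t (Icc 0 t) (fun r => (T.toFun r).comp B)
      (L.stochasticIntegral t fun r => (T.toFun r).comp B) := by
    -- Existence rules out the conventional value `0`.
    rw [stochasticIntegral, dif_pos hex]
    exact hex.choose_spec
  have hcongr : EqOn (fun r : ℝ => L.symbol ((Icc 0 t).indicator
      (fun s => ((T.toFun s).comp B).adjoint v) r.toNNReal))
      (fun r : ℝ => L.symbol (((T.toFun r.toNNReal).comp B).adjoint v)) (Icc 0 (t : ℝ)) := by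
    intro r hr
    have hmem : r.toNNReal ∈ Icc 0 t := ⟨zero_le, Real.toNNReal_le_iff_le_coe.2 hr.2⟩
    simp only [indicator_of_mem hmem]
  have h1 := (hint v).integrableOn_symbol
  have h2 := (hint v).integral_exp
  rw [integrableOn_congr_fun hcongr measurableSet_Icc] at h1
  rw [setIntegral_congr_fun measurableSet_Icc hcongr, integral_Icc_eq_integral_Ioc,
    ← intervalIntegral.integral_of_le t.coe_nonneg] at h2
  refine ⟨(intervalIntegrable_iff_integrableOn_Icc_of_le t.2).2 h1, ?_⟩
  rw [← h2, charFun_apply]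
  exact integral_map (AEEqFun.aemeasurable _) (by fun_prop)

/-- Fourier form of `ν_{s+t} = T_s ν_t * ν_s`: split the exponent at `s`, substitute `r ↦ s + r` and
use the semigroup law. -/
theorem charFun_convolutionLaw_add (L : CylindricalLevyProcess U ℱ P) (T : C0Semigroup V)
    (B : U →L[ℝ] V)
    (hTB : ∃ T₀ : ℝ≥0, 0 < T₀ ∧ L.StochasticallyIntegrable T₀ fun s => (T.toFun s).comp B)
    (s t : ℝ≥0) (v : V) :
    charFun (L.convolutionLaw T B (s + t) : Measure V) v =
      charFun (L.convolutionLaw T B t : Measure V) ((T.toFun s).adjoint v) *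
        charFun (L.convolutionLaw T B s : Measure V) v := by
  obtain ⟨i1, e1⟩ := L.charFun_convolutionLaw T B hTB (s + t) v
  obtain ⟨i2, e2⟩ := L.charFun_convolutionLaw T B hTB s v
  obtain ⟨-, e3⟩ := L.charFun_convolutionLaw T B hTB t ((T.toFun s).adjoint v)
  have h := intervalIntegral.integral_comp_add_left (a := 0) (b := t)
    (fun r : ℝ => L.symbol (((T.toFun r.toNNReal).comp B).adjoint v)) (s : ℝ)
  rw [add_zero, ← NNReal.coe_add] at h
  rw [e1, e2, e3, ← Complex.exp_add,
    ← intervalIntegral.integral_add_adjacent_intervals i2 (i2.symm.trans i1), ← h]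
  refine congrArg Complex.exp ((add_comm _ _).trans ?_)
  congr 1
  refine intervalIntegral.integral_congr fun r hr => ?_
  rw [uIcc_of_le t.coe_nonneg] at hr
  rw [Real.toNNReal_add s.coe_nonneg hr.1, Real.toNNReal_coe, C0Semigroup.adjoint_comp_add]

theorem isStationaryMeasure_iff (L : CylindricalLevyProcess U ℱ P) (T : C0Semigroup V)
    (B : U →L[ℝ] V) (ρ : ProbabilityMeasure V) :
    L.IsStationaryMeasure T B ρ ↔ ∀ (t : ℝ≥0) (v : V), charFun (ρ : Measure V) v =
      charFun (ρ : Measure V) ((T.toFun t).adjoint v) *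
        charFun (L.convolutionLaw T B t : Measure V) v := by
  have : SecondCountableTopology V := UniformSpace.secondCountable_of_separable V
  refine forall_congr' fun t => ?_
  have hp : IsProbabilityMeasure ((ρ : Measure V).map (T.toFun t)) :=
    Measure.isProbabilityMeasure_map (T.toFun t).continuous.aemeasurable
  refine ⟨fun h v => ?_, fun h => Measure.ext_of_charFun (funext fun v => ?_)⟩
  · nth_rw 1 [h]
    rw [charFun_conv, charFun_map_continuousLinearMap]
  · rw [charFun_conv, charFun_map_continuousLinearMap, h v]

/-- Let `r → ∞` in `ν_{t+r} = T_t ν_r * ν_t`. -/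
theorem isStationaryMeasure_of_tendsto (L : CylindricalLevyProcess U ℱ P) (T : C0Semigroup V)
    (B : U →L[ℝ] V)
    (hTB : ∃ T₀ : ℝ≥0, 0 < T₀ ∧ L.StochasticallyIntegrable T₀ fun s => (T.toFun s).comp B)
    (ν : ProbabilityMeasure V)
    (hν : Tendsto (fun t : ℝ≥0 => L.convolutionLaw T B t) atTop (𝓝 ν)) :
    L.IsStationaryMeasure T B ν := by
  refine (L.isStationaryMeasure_iff T B ν).2 fun t v => ?_
  have h1 := ProbabilityMeasure.tendsto_charFun
    (hν.comp (tendsto_atTop_mono (fun r => le_add_self) tendsto_id :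
      Tendsto (fun r : ℝ≥0 => t + r) atTop atTop)) v
  have h2 := (ProbabilityMeasure.tendsto_charFun hν ((T.toFun t).adjoint v)).mul_const
    (charFun (L.convolutionLaw T B t : Measure V) v)
  refine tendsto_nhds_unique h1 (h2.congr fun r => ?_)
  exact (L.charFun_convolutionLaw_add T B hTB t r v).symm

end CylindricalLevyProcess

/-! ### Tightness of cofactors -/

section Tightness

variable {V : Type*} [NormedAddCommGroup V] [MeasurableSpace V] [BorelSpace V]
  [SecondCountableTopology V]

open scoped Pointwise in
/-- If `μ ∗ ρ` and `ρ` range over tight sets of probability measures, then so does `μ`. -/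
theorem isTightMeasureSet_of_conv {ι : Type*} {μ ρ : ι → Measure V}
    [∀ i, IsProbabilityMeasure (μ i)] [∀ i, IsProbabilityMeasure (ρ i)]
    (hρ : IsTightMeasureSet (range ρ)) (hconv : IsTightMeasureSet (range fun i => μ i ∗ ρ i)) :
    IsTightMeasureSet (range μ) := by
  rw [isTightMeasureSet_iff_exists_isCompact_measure_compl_le] at *
  intro ε hε
  obtain ⟨K, hK, hK'⟩ := hconv (ε / 2) (ENNReal.half_pos hε.ne')
  obtain ⟨C, hC, hC'⟩ := hρ (ε / 2) (ENNReal.half_pos hε.ne')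
  -- If `x + y ∈ K` and `y ∈ C`, then `x ∈ K - C`.
  refine ⟨K - C, by simpa only [sub_image_prod] using (hK.prod hC).image continuous_sub, ?_⟩
  rintro _ ⟨i, rfl⟩
  have hKm : MeasurableSet Kᶜ := hK.measurableSet.compl
  calc μ i (K - C)ᶜ = (μ i).prod (ρ i) ((K - C)ᶜ ×ˢ univ) := by simp
    _ ≤ (μ i).prod (ρ i) ((fun p : V × V => p.1 + p.2) ⁻¹' Kᶜ ∪ univ ×ˢ Cᶜ) := by
        refine measure_mono fun p hp => ?_
        by_contra hcon
        simp only [mem_union, mem_preimage, mem_compl_iff, mem_prod, mem_univ, true_and,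
          not_or, not_not] at hcon
        exact hp.1 ⟨p.1 + p.2, hcon.1, p.2, hcon.2, by simp⟩
    _ ≤ (μ i).prod (ρ i) ((fun p : V × V => p.1 + p.2) ⁻¹' Kᶜ) +
          (μ i).prod (ρ i) (univ ×ˢ Cᶜ) := measure_union_le _ _
    _ = (μ i ∗ ρ i) Kᶜ + ρ i Cᶜ := by
        rw [Measure.conv, Measure.map_apply (by fun_prop) hKm]
        simp
    _ ≤ ε / 2 + ε / 2 := add_le_add (hK' _ ⟨i, rfl⟩) (hC' _ ⟨i, rfl⟩)
    _ = ε := ENNReal.add_halves ε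

end Tightness

/-! ### Time averages and invariant cofactors -/

section Invariant

variable {V : Type*} [NormedAddCommGroup V] [InnerProductSpace ℝ V] [MeasurableSpace V]
  [BorelSpace V]

namespace C0Semigroup

variable (T : C0Semigroup V)

theorem measurable_uncurry : Measurable fun p : ℝ × V => T.toFun p.1.toNNReal p.2 :=
  measurable_uncurry_of_continuous_of_measurable
    (u := fun (r : ℝ) (x : V) => T.toFun r.toNNReal x)
    (fun x => (T.strongly_continuous x).comp continuous_real_toNNReal)
    fun r => (T.toFun r.toNNReal).continuous.measurable

theorem cond_Ioc_isProbabilityMeasure (n : ℕ) :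
    IsProbabilityMeasure (cond (volume : Measure ℝ) (Ioc 0 ((n : ℝ) + 1))) :=
  cond_isProbabilityMeasure_of_finite (by simp; positivity) (by simp)

/-- The time average over `[0, n + 1]` of the images of `β` under the semigroup. -/
noncomputable def timeAverage (β : ProbabilityMeasure V) (n : ℕ) : ProbabilityMeasure V :=
  ⟨((cond (volume : Measure ℝ) (Ioc 0 ((n : ℝ) + 1))).prod (β : Measure V)).map
      fun p => T.toFun p.1.toNNReal p.2,
    have := cond_Ioc_isProbabilityMeasure n
    Measure.isProbabilityMeasure_map T.measurable_uncurry.aemeasurable⟩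

variable [CompleteSpace V]

theorem continuous_charFun_adjoint (β : ProbabilityMeasure V) (v : V) :
    Continuous fun r : ℝ => charFun (β : Measure V) ((T.toFun r.toNNReal).adjoint v) := by
  simp only [charFun_apply, ContinuousLinearMap.adjoint_inner_right]
  refine continuous_of_dominated (bound := fun _ => 1) (fun r => ?_)
    (fun r => ae_of_all _ fun x => (Complex.norm_exp_ofReal_mul_I _).le) (integrable_const _)
    (ae_of_all _ fun x => ?_)
  · exact Continuous.aestronglyMeasurable (by fun_prop)
  · have := (T.strongly_continuous x).comp continuous_real_toNNReal
    simp only [Function.comp_def] at this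
    fun_prop

end C0Semigroup

variable [CompleteSpace V] [SecondCountableTopology V]

/-- Cofactors of a fixed probability measure with respect to a convergent sequence accumulate. -/
theorem exists_ultrafilter_tendsto_of_conv_eq {μ ρ : ℕ → ProbabilityMeasure V}
    {lam ν : ProbabilityMeasure V} (hρ : Tendsto ρ atTop (𝓝 ν))
    (h : ∀ n, (μ n : Measure V) ∗ (ρ n : Measure V) = lam) :
    ∃ (β : ProbabilityMeasure V) (𝒰 : Ultrafilter ℕ), (𝒰 : Filter ℕ) ≤ atTop ∧
      Tendsto μ 𝒰 (𝓝 β) ∧ (β : Measure V) ∗ (ν : Measure V) = lam := by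
  have hcomp : IsCompact (closure (range ρ)) :=
    hρ.isCompact_insert_range.closure_of_subset (subset_insert _ _)
  have hρt : IsTightMeasureSet (range fun n => (ρ n : Measure V)) := by
    convert isTightMeasureSet_of_isCompact_closure hcomp using 1
    ext; simp
  have hlamt : IsTightMeasureSet (range fun n => (μ n : Measure V) ∗ (ρ n : Measure V)) := by
    simp only [h, range_const]
    exact isTightMeasureSet_singleton
  have hμt := isTightMeasureSet_of_conv hρt hlamt
  have hμc : IsCompact (closure (range μ)) := by
    refine isCompact_closure_of_isTightMeasureSet ?_
    convert hμt using 1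
    ext; simp
  -- An ultrafilter finer than `atTop` replaces the choice of a convergent subsequence.
  obtain ⟨β, -, hβ⟩ := hμc.ultrafilter_le_nhds' ((Ultrafilter.of atTop).map μ)
    (mem_of_superset (Ultrafilter.mem_map.2 (by rw [preimage_range]; exact univ_mem))
      subset_closure)
  have hle := Ultrafilter.of_le (atTop : Filter ℕ)
  refine ⟨β, Ultrafilter.of atTop, hle, hβ, Measure.ext_of_charFun (funext fun v => ?_)⟩
  rw [charFun_conv]
  refine tendsto_nhds_unique ((ProbabilityMeasure.tendsto_charFun hβ v).mul
    (ProbabilityMeasure.tendsto_charFun (hρ.mono_left hle) v)) ?_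
  simp only [← charFun_conv, h]
  exact tendsto_const_nhds

namespace C0Semigroup

variable (T : C0Semigroup V)

theorem charFun_timeAverage (β : ProbabilityMeasure V) (n : ℕ) (v : V) :
    charFun (T.timeAverage β n : Measure V) v = ((n : ℝ) + 1)⁻¹ •
      ∫ r in (0 : ℝ)..(n + 1), charFun (β : Measure V) ((T.toFun r.toNNReal).adjoint v) := by
  have := cond_Ioc_isProbabilityMeasure n
  have hcont : Continuous fun x : V => Complex.exp (⟪x, v⟫_ℝ * Complex.I) := by fun_prop
  have hint : Integrable (fun p : ℝ × V =>
      Complex.exp (⟪T.toFun p.1.toNNReal p.2, v⟫_ℝ * Complex.I))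
      ((cond (volume : Measure ℝ) (Ioc 0 ((n : ℝ) + 1))).prod (β : Measure V)) :=
    Integrable.of_bound (hcont.measurable.comp T.measurable_uncurry).aestronglyMeasurable 1
      (ae_of_all _ fun p => (Complex.norm_exp_ofReal_mul_I _).le)
  change charFun (((cond (volume : Measure ℝ) (Ioc 0 ((n : ℝ) + 1))).prod (β : Measure V)).map
      fun p => T.toFun p.1.toNNReal p.2) v = _
  rw [charFun_apply, integral_map T.measurable_uncurry.aemeasurable hcont.aestronglyMeasurable,
    integral_prod _ hint, intervalIntegral.integral_of_le (by positivity), ProbabilityTheory.cond,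
    integral_smul_measure]
  have hn : (0 : ℝ) ≤ (n : ℝ) + 1 := by positivity
  rw [Real.volume_Ioc, sub_zero, ENNReal.toReal_inv, ENNReal.toReal_ofReal hn]
  simp only [charFun_apply, ContinuousLinearMap.adjoint_inner_right]

/-- Applying `T(s)` moves the window `[0, n + 1]` to `[s, s + n + 1]`. The two integrals differ by
two pieces of length `s` with integrand bounded by `1`. -/
theorem norm_charFun_timeAverage_sub_le (β : ProbabilityMeasure V) (n : ℕ) (s : ℝ≥0) (v : V) :
    ‖charFun (T.timeAverage β n : Measure V) ((T.toFun s).adjoint v) -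
      charFun (T.timeAverage β n : Measure V) v‖ ≤ 2 * s / (n + 1) := by
  set q : ℝ → ℂ := fun r => charFun (β : Measure V) ((T.toFun r.toNNReal).adjoint v) with hq
  have hqc : Continuous q := T.continuous_charFun_adjoint β v
  have hn : (0 : ℝ) ≤ (n : ℝ) + 1 := by positivity
  have hi : ∀ a b, IntervalIntegrable q volume a b := fun a b => hqc.intervalIntegrable a b
  have h1 : ∫ r in (0 : ℝ)..(n + 1), charFun (β : Measure V)
      ((T.toFun r.toNNReal).adjoint ((T.toFun s).adjoint v)) =
      ∫ r in (s : ℝ)..(s + (n + 1)), q r := by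
    have h := intervalIntegral.integral_comp_add_left (a := 0) (b := (n : ℝ) + 1) q (s : ℝ)
    rw [add_zero] at h
    rw [← h]
    refine intervalIntegral.integral_congr fun r hr => ?_
    rw [uIcc_of_le hn] at hr
    simp only [hq]
    rw [Real.toNNReal_add s.coe_nonneg hr.1, Real.toNNReal_coe, adjoint_add]
  have h2 : (∫ r in (s : ℝ)..(s + (n + 1)), q r) - ∫ r in (0 : ℝ)..(n + 1), q r =
      (∫ r in ((n : ℝ) + 1)..(s + (n + 1)), q r) - ∫ r in (0 : ℝ)..s, q r := by
    linear_combination intervalIntegral.integral_add_adjacent_intervals (hi 0 s) (hi s (s + (n + 1)))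
      - intervalIntegral.integral_add_adjacent_intervals (hi 0 (n + 1)) (hi (n + 1) (s + (n + 1)))
  have hb : ∀ a b : ℝ, a ≤ b → ‖∫ r in a..b, q r‖ ≤ b - a := fun a b hab => by
    have := intervalIntegral.norm_integral_le_of_norm_le_const (a := a) (b := b) (f := q) (C := 1)
      fun r _ => norm_charFun_le_one _
    rwa [one_mul, abs_of_nonneg (sub_nonneg.2 hab)] at this
  rw [charFun_timeAverage, charFun_timeAverage, h1, ← smul_sub, h2, norm_smul, norm_inv,
    Real.norm_of_nonneg hn, inv_mul_eq_div]
  gcongr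
  refine (norm_sub_le _ _).trans ?_
  have hs := s.coe_nonneg
  have e1 := hb ((n : ℝ) + 1) (s + (n + 1)) (by linarith)
  have e2 := hb 0 s hs
  linarith

/-- The product with the characteristic function of `ν` does not depend on `s`, so averaging leaves
it unchanged. -/
theorem timeAverage_conv {β lam ν : ProbabilityMeasure V}
    (h : ∀ (s : ℝ≥0) (v : V), charFun (β : Measure V) ((T.toFun s).adjoint v) *
      charFun (ν : Measure V) v = charFun (lam : Measure V) v) (n : ℕ) :
    (T.timeAverage β n : Measure V) ∗ (ν : Measure V) = lam := by
  refine Measure.ext_of_charFun (funext fun v => ?_)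
  rw [charFun_conv, charFun_timeAverage, smul_mul_assoc, ← intervalIntegral.integral_mul_const]
  simp only [h]
  rw [intervalIntegral.integral_const, sub_zero, smul_smul, inv_mul_cancel₀ (by positivity),
    one_smul]

/-- If all images of `β` under the semigroup are cofactors of `ν` in `lam`, then there is an
invariant cofactor. -/
theorem exists_invariant_cofactor {β lam ν : ProbabilityMeasure V}
    (h : ∀ (s : ℝ≥0) (v : V), charFun (β : Measure V) ((T.toFun s).adjoint v) *
      charFun (ν : Measure V) v = charFun (lam : Measure V) v) :
    ∃ γ : ProbabilityMeasure V, (∀ t : ℝ≥0, (γ : Measure V).map (T.toFun t) = (γ : Measure V)) ∧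
      (lam : Measure V) = (γ : Measure V) ∗ (ν : Measure V) := by
  -- The averages are cofactors of the constant sequence `ν`, so they accumulate at some cofactor
  -- `γ`.
  obtain ⟨γ, 𝒰, h𝒰, hγ, hconv⟩ := exists_ultrafilter_tendsto_of_conv_eq
    (tendsto_const_nhds (x := ν)) (T.timeAverage_conv h)
  refine ⟨γ, fun s => ?_, hconv.symm⟩
  have : IsProbabilityMeasure ((γ : Measure V).map (T.toFun s)) :=
    Measure.isProbabilityMeasure_map (T.toFun s).continuous.aemeasurable
  refine Measure.ext_of_charFun (funext fun v => ?_)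
  rw [charFun_map_continuousLinearMap, ← sub_eq_zero]
  refine tendsto_nhds_unique ((ProbabilityMeasure.tendsto_charFun hγ _).sub
    (ProbabilityMeasure.tendsto_charFun hγ v)) ?_
  refine squeeze_zero_norm (fun n => T.norm_charFun_timeAverage_sub_le β n s v) ?_
  refine Tendsto.mono_left ?_ h𝒰
  exact tendsto_const_nhds.div_atTop
    (tendsto_atTop_add_const_right _ _ tendsto_natCast_atTop_atTop)

end C0Semigroup

end Invariant

/-! ### The main theorem -/

theorem mainTheorem5
    {Ω : Type*} {mΩ : MeasurableSpace Ω} (P : Measure Ω) [IsProbabilityMeasure P]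
    (ℱ : Filtration ℝ≥0 mΩ)
    {U : Type*} [NormedAddCommGroup U] [InnerProductSpace ℝ U] [CompleteSpace U]
    [TopologicalSpace.SeparableSpace U]
    {V : Type*} [NormedAddCommGroup V] [InnerProductSpace ℝ V] [CompleteSpace V]
    [TopologicalSpace.SeparableSpace V] [MeasurableSpace V] [BorelSpace V]
    (L : CylindricalLevyProcess U ℱ P) (T : C0Semigroup V) (B : U →L[ℝ] V)
    (hTB : ∃ T₀ : ℝ≥0, 0 < T₀ ∧
      L.StochasticallyIntegrable T₀ fun s => (T.toFun s).comp B)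
    (ν : ProbabilityMeasure V)
    (hν : Tendsto (fun t : ℝ≥0 => L.convolutionLaw T B t) atTop (𝓝 ν)) :
    L.IsStationaryMeasure T B ν ∧
      ∀ lam : ProbabilityMeasure V, L.IsStationaryMeasure T B lam →
        ∃ β : ProbabilityMeasure V,
          (∀ t : ℝ≥0, (β : Measure V).map (T.toFun t) = (β : Measure V)) ∧
          (lam : Measure V) = (β : Measure V) ∗ (ν : Measure V) := by
  have : SecondCountableTopology V := UniformSpace.secondCountable_of_separable V
  have hst := L.isStationaryMeasure_of_tendsto T B hTB ν hν
  refine ⟨hst, fun lam hlam => ?_⟩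
  let μ : ℕ → ProbabilityMeasure V := fun n =>
    ⟨(lam : Measure V).map (T.toFun n),
      Measure.isProbabilityMeasure_map (T.toFun n).continuous.aemeasurable⟩
  obtain ⟨β, -, -, -, hβ⟩ := exists_ultrafilter_tendsto_of_conv_eq (μ := μ)
    (hν.comp (tendsto_natCast_atTop_atTop (R := ℝ≥0))) fun n => (hlam n).symm
  -- Write `^` for characteristic functions. Since `λ = β * ν`, `λ^(v) = λ^(T*(s)v) ν_s^(v) =
  -- β^(T*(s)v) ν^(T*(s)v) ν_s^(v)`, and stationarity of `ν` turns the last two factors into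
  -- `ν^(v)`.
  refine T.exists_invariant_cofactor (β := β) fun s v => ?_
  rw [(L.isStationaryMeasure_iff T B ν).1 hst s v, (L.isStationaryMeasure_iff T B lam).1 hlam s v,
    ← hβ, charFun_conv, mul_assoc]
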